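/- Conventions. An oriented ordered $n$-linkoid diagram $L$ ($n\ge 0$) is a smooth generic immersion into $S^2$ of $n$ numbered oriented unit intervals and finitely many oriented circles, with finitely many transverse double points, none of them at an endpoint of an interval, and with over/under information at each double point. Two such diagrams are equivalent if they are related by a finite sequence of isotopies of $S^2$ (and orientation-preserving reparametrizations) and oriented Reidemeister moves I, II, III performed in discs containing no endpoints; the equivalence classes are the oriented ordered $n$-linkoids. The fundamental quandle $Q(L)$ is generated by the arcs of $L$ (the connected components of the source minus the preimages of undercrossings), with one relation at each crossing: if the lower strand arrives along the arc $a$ and leaves along the arc $b$, and the upper strand is the arc $y$, the relation is $b=a\triangleright y$ at a positive and $a=b\triangleright y$ at a negative crossing. The fundamental pointed quandle is $P(L)=(Q(L),l_1,h_1,\dots,l_n,h_n)$, where $l_i,h_i$ are the arcs at the start and at the end of the $i$-th interval. A $2n$-pointed quandle $\mathcal X=(X,x_1,\dots,x_{2n})$ is a quandle with $2n$ chosen elements; $\hom$ and $\operatorname{End}$ of pointed quandles consist of the quandle homomorphisms that preserve the basepoints in order. For a finite $2n$-pointed quandle $\mathcal X$ and $S\subseteq\operatorname{End}(\mathcal X)$,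 the pointed quandle coloring quiver $\mathcal Q^S_{\mathcal X}(L)$ is the directed multigraph with vertex set $V=\hom(P(L),\mathcal X)$ and with $|\{\varphi\in S : \varphi\circ\alpha=\beta\}|$ edges from $\alpha$ to $\beta$. Let $\deg^+(f)$ be the number of edges into $f$, and $$\Phi^{\deg^+,S}_{\mathcal X}(L)=\sum_{f\in V}u^{\deg^+(f)}\in\mathbb Z[u].$$ For a finite quandle $X=\{x_1,\dots,x_k\}$ and sets $S_{i,j}\subseteq\operatorname{End}(X,x_i,x_j)$, $\mathbf S=(S_{i,j})$, the in-degree quiver polynomial matrix of a $1$-linkoid diagram $L$ is the $k\times k$ matrix $\Phi^{M_k,\deg^+}_{X,\mathbf S}(L)$ with $(i,j)$ entry $\Phi^{\deg^+,S_{i,j}}_{(X,x_i,x_j)}(L)$. Statement. (1) For every $n\ge0$, every finite $2n$-pointed quandle $\mathcal X$ and every $S\subseteq\operatorname{End}(\mathcal X)$, the set $\hom(P(L),\mathcal X)$ is finite for every oriented ordered $n$-linkoid diagram $L$, and $\Phi^{\deg^+,S}_{\mathcal X}(L)=\Phi^{\deg^+,S}_{\mathcal X}(L')$ whenever $L$ and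 $L'$ are equivalent; that is, the in-degree quiver polynomial is an invariant of $n$-linkoids. (2) For every finite quandle $X=\{x_1,\dots,x_k\}$ and every family $\mathbf S=(S_{i,j})$ with $S_{i,j}\subseteq\operatorname{End}(X,x_i,x_j)$, $\Phi^{M_k,\deg^+}_{X,\mathbf S}(L)=\Phi^{M_k,\deg^+}_{X,\mathbf S}(L')$ for all equivalent $1$-linkoid diagrams $L,L'$; that is, the in-degree quiver polynomial matrix is an invariant of $1$-linkoids. -/

import Mathlib

open Set Filter Topology
open scoped Manifold ContDiff

universe u v

noncomputable section

namespace LinkoidTheory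

/-! ### Quandles given by generators and relations -/

/-- Formal quandle expressions in a set `α` of generators. -/
inductive QuandleTerm (α : Type u) : Type u
  | gen (a : α) : QuandleTerm α
  | act (x y : QuandleTerm α) : QuandleTerm α
  | invAct (x y : QuandleTerm α) : QuandleTerm α

/-- The congruence on formal expressions generated by the quandle axioms and the relations `r`. -/
inductive QuandleTerm.Rel {α : Type u} (r : QuandleTerm α → QuandleTerm α → Prop) :
    QuandleTerm α → QuandleTerm α → Prop
  | of {x y} : r x y → Rel r x y
  | refl (x) : Rel r x x
  | symm {x y} : Rel r x y → Rel r y x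
  | trans {x y z} : Rel r x y → Rel r y z → Rel r x z
  | act_congr {x x' y y'} : Rel r x x' → Rel r y y' → Rel r (.act x y) (.act x' y')
  | invAct_congr {x x' y y'} : Rel r x x' → Rel r y y' → Rel r (.invAct x y) (.invAct x' y')
  | self_distrib (x y z) : Rel r (.act x (.act y z)) (.act (.act x y) (.act x z))
  | left_inv (x y) : Rel r (.invAct x (.act x y)) y
  | right_inv (x y) : Rel r (.act x (.invAct x y)) y
  | fix (x) : Rel r (.act x x) x

/-- The setoid of the congruence `QuandleTerm.Rel r`. -/
def QuandleTerm.setoid {α : Type u} (r : QuandleTerm α → QuandleTerm α → Prop) :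
    Setoid (QuandleTerm α) :=
  ⟨QuandleTerm.Rel r, ⟨.refl, .symm, .trans⟩⟩

/-- The quandle `⟨α ∣ r⟩`. -/
def PresentedQuandle {α : Type u} (r : QuandleTerm α → QuandleTerm α → Prop) : Type u :=
  Quotient (QuandleTerm.setoid r)

namespace PresentedQuandle

variable {α : Type u} {r : QuandleTerm α → QuandleTerm α → Prop}

/-- The class of a generator. -/
def of (r : QuandleTerm α → QuandleTerm α → Prop) (a : α) : PresentedQuandle r :=
  Quotient.mk (QuandleTerm.setoid r) (.gen a)

/-- Mathlib writes the quandle operation as a left action: `Shelf.act y x` is `x ▷ y`. -/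
instance : Quandle (PresentedQuandle r) where
  act := Quotient.map₂ .act fun _ _ h _ _ h' => .act_congr h h'
  invAct := Quotient.map₂ .invAct fun _ _ h _ _ h' => .invAct_congr h h'
  self_distrib := by
    rintro ⟨x⟩ ⟨y⟩ ⟨z⟩
    exact Quotient.sound (.self_distrib x y z)
  left_inv := by
    rintro ⟨x⟩ ⟨y⟩
    exact Quotient.sound (.left_inv x y)
  right_inv := by
    rintro ⟨x⟩ ⟨y⟩
    exact Quotient.sound (.right_inv x y)
  fix := by
    rintro ⟨x⟩
    exact Quotient.sound (.fix x)

end PresentedQuandle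

/-! ### Pointed quandles -/

/-- An `N`-pointed quandle. -/
structure PointedQuandle (N : ℕ) where
  carrier : Type u
  [quandle : Quandle carrier]
  pt : Fin N → carrier

attribute [instance] PointedQuandle.quandle

/-- Pointed quandle homomorphisms. -/
@[ext]
structure PointedHom {N : ℕ} (P : PointedQuandle.{u} N) (R : PointedQuandle.{v} N) where
  hom : ShelfHom P.carrier R.carrier
  map_pt : ∀ i, hom (P.pt i) = R.pt i

/-- Composition of pointed quandle homomorphisms. -/
def PointedHom.comp {N : ℕ} {P : PointedQuandle.{u} N} {R T : PointedQuandle.{v} N}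
    (g : PointedHom R T) (f : PointedHom P R) : PointedHom P T where
  hom := g.hom.comp f.hom
  map_pt i := by rw [ShelfHom.comp_apply, f.map_pt, g.map_pt]

/-! ### Linkoid diagrams on the sphere -/

/-- Euclidean three-space. -/
abbrev E3 : Type := EuclideanSpace ℝ (Fin 3)

/-- The unit sphere, with Mathlib's topology and smooth structure. -/
abbrev S2 : Type := Metric.sphere (0 : E3) 1

/-- The disjoint union of `n` unit intervals and `m` unit circles. -/
abbrev Src (n m : ℕ) : Type := (Fin n × unitInterval) ⊕ (Fin m × UnitAddCircle)

namespace Src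

variable {n m : ℕ}

/-- The start of the `i`-th interval. -/
def leg (i : Fin n) : Src n m := .inl (i, 0)

/-- The end of the `i`-th interval. -/
def head (i : Fin n) : Src n m := .inl (i, 1)

/-- Being an end of one of the intervals. -/
def IsEnd (x : Src n m) : Prop := ∃ i, x = leg i ∨ x = head i

/-- The point reached from `x` by moving along its component for the signed time `s` (on an
interval the motion stops at the ends). -/
def flow : Src n m → ℝ → Src n m
  | .inl (i, t), s => .inl (i, Set.projIcc 0 1 zero_le_one ((t : ℝ) + s))
  | .inr (j, θ), s => .inr (j, θ + (s : UnitAddCircle))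

/-- The times for which one can move from `x` without leaving its component. -/
def reach : Src n m → Set ℝ
  | .inl (_, t) => {s | (t : ℝ) + s ∈ Icc (0 : ℝ) 1}
  | .inr _ => univ

end Src

/-- The triple product `det (p, v, w)`. For tangent vectors `v`, `w` of the sphere at `p` it is
positive exactly when `(v, w)` is a positively oriented basis of the tangent plane. -/
def tripleDet (p v w : E3) : ℝ := Matrix.det (Matrix.of ![p.ofLp, v.ofLp, w.ofLp])

/-- The velocity at `x` of a map into the sphere, along the orientation of the component of `x`
(one-sided at the ends of an interval). -/
def velocity {n m : ℕ} (f : Src n m → S2) (x : Src n m) : E3 :=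
  derivWithin (fun s : ℝ => (f (x.flow s) : E3)) x.reach 0

/-- An oriented ordered `n`-linkoid diagram with `m` closed components: a smooth generic immersion
of `n` intervals and `m` circles into the sphere whose multiple points are finitely many transverse
double points away from the ends of the intervals, with over/under information: of the two
preimages of a double point exactly one belongs to the set `under`. -/
structure LinkoidDiagram (n m : ℕ) where
  toFun : Src n m → S2
  smooth : ∀ x : Src n m, ContDiffOn ℝ ∞ (fun s : ℝ => (toFun (x.flow s) : E3)) x.reach
  immersion : ∀ x, velocity toFun x ≠ 0
  not_end : ∀ x y : Src n m, x ≠ y → toFun x = toFun y → ¬ x.IsEnd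
  transverse : ∀ x y, x ≠ y → toFun x = toFun y →
    LinearIndependent ℝ ![velocity toFun x, velocity toFun y]
  no_triple : ∀ x y z, toFun x = toFun y → toFun y = toFun z → x = y ∨ y = z ∨ x = z
  finite_double : {x | ∃ y, x ≠ y ∧ toFun x = toFun y}.Finite
  under : Set (Src n m)
  double_of_under : ∀ x ∈ under, ∃ y, x ≠ y ∧ toFun x = toFun y
  under_iff : ∀ x y, x ≠ y → toFun x = toFun y → (x ∈ under ↔ y ∉ under)

namespace LinkoidDiagram

variable {n m : ℕ}

/-- `p` and `q` are the over-preimage and the under-preimage of one crossing. -/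
def IsCrossing (L : LinkoidDiagram n m) (p q : Src n m) : Prop :=
  p ≠ q ∧ L.toFun p = L.toFun q ∧ q ∈ L.under

/-- The crossing with over-preimage `p` and under-preimage `q` is positive: the over-direction
followed by the under-direction is a positive basis, so that the lower strand passes from the
right to the left of the upper strand. -/
def IsPositive (L : LinkoidDiagram n m) (p q : Src n m) : Prop :=
  0 < tripleDet (L.toFun q) (velocity L.toFun p) (velocity L.toFun q)

/-- The arcs of a diagram: the connected components of the source minus the undercrossings. -/
def Arc (L : LinkoidDiagram n m) : Type := ConnectedComponents {x : Src n m // x ∉ L.under}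

/-- The arc through a point. -/
def arc (L : LinkoidDiagram n m) (x : Src n m) (hx : x ∉ L.under) : L.Arc :=
  ConnectedComponents.mk (⟨x, hx⟩ : {x : Src n m // x ∉ L.under})

/-- `a` is the arc that arrives at `q`. -/
def IsIncoming (L : LinkoidDiagram n m) (q : Src n m) (a : L.Arc) : Prop :=
  ∀ᶠ s in 𝓝[<] (0 : ℝ), ∃ h : q.flow s ∉ L.under, L.arc (q.flow s) h = a

/-- `a` is the arc that leaves `q`. -/
def IsOutgoing (L : LinkoidDiagram n m) (q : Src n m) (a : L.Arc) : Prop :=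
  ∀ᶠ s in 𝓝[>] (0 : ℝ), ∃ h : q.flow s ∉ L.under, L.arc (q.flow s) h = a

/-- The crossing relations. If the lower strand arrives along `a` and leaves along `b` under the
arc `y`, then `b = a ▷ y` at a positive and `a = b ▷ y` at a negative crossing. -/
inductive CrossingRel (L : LinkoidDiagram n m) : QuandleTerm L.Arc → QuandleTerm L.Arc → Prop
  | pos (p q : Src n m) (hp : p ∉ L.under) (a b : L.Arc) :
      L.IsCrossing p q → L.IsPositive p q → L.IsIncoming q a → L.IsOutgoing q b →
      CrossingRel L (.gen b) (.act (.gen (L.arc p hp)) (.gen a))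
  | neg (p q : Src n m) (hp : p ∉ L.under) (a b : L.Arc) :
      L.IsCrossing p q → ¬ L.IsPositive p q → L.IsIncoming q a → L.IsOutgoing q b →
      CrossingRel L (.gen a) (.act (.gen (L.arc p hp)) (.gen b))

/-- The fundamental quandle of a diagram. -/
abbrev FundamentalQuandle (L : LinkoidDiagram n m) : Type := PresentedQuandle L.CrossingRel

theorem not_under_of_isEnd (L : LinkoidDiagram n m) {x : Src n m} (hx : x.IsEnd) :
    x ∉ L.under := fun h =>
  let ⟨y, hne, he⟩ := L.double_of_under x h
  L.not_end x y hne he hx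

/-- The class in the fundamental quandle of the arc at the leg of the `i`-th open component. -/
def legLabel (L : LinkoidDiagram n m) (i : Fin n) : L.FundamentalQuandle :=
  PresentedQuandle.of _ (L.arc (Src.leg i) (L.not_under_of_isEnd ⟨i, Or.inl rfl⟩))

/-- The class in the fundamental quandle of the arc at the head of the `i`-th open component. -/
def headLabel (L : LinkoidDiagram n m) (i : Fin n) : L.FundamentalQuandle :=
  PresentedQuandle.of _ (L.arc (Src.head i) (L.not_under_of_isEnd ⟨i, Or.inr rfl⟩))

/-- The fundamental pointed quandle, with basepoints `l₁, h₁, l₂, h₂, …, lₙ, hₙ`. -/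
def fundamentalPointedQuandle (L : LinkoidDiagram n m) : PointedQuandle.{0} (2 * n) where
  carrier := L.FundamentalQuandle
  pt j :=
    if (j : ℕ) % 2 = 0 then L.legLabel ⟨(j : ℕ) / 2, by omega⟩
    else L.headLabel ⟨(j : ℕ) / 2, by omega⟩

/-! ### Isotopy and Reidemeister moves -/

/-- Orientation preserving smooth reparametrizations of the source that respect the numbering of
the intervals (the circles may be permuted). -/
def IsReparam (φ : Src n m ≃ₜ Src n m) : Prop :=
  (∀ i, φ (Src.leg i) = Src.leg i) ∧ (∀ i, φ (Src.head i) = Src.head i) ∧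
  ∀ x, ∃ h : ℝ → ℝ, ContDiff ℝ ∞ h ∧ h 0 = 0 ∧ (∀ s, 0 < deriv h s) ∧
    ∀ s ∈ x.reach, φ (x.flow s) = (φ x).flow (h s)

/-- Smooth ambient isotopies of the sphere. -/
structure SphereIsotopy where
  diffeo : ℝ → Diffeomorph (𝓡 2) (𝓡 2) S2 S2 ∞
  smooth : ContMDiff (𝓘(ℝ, ℝ).prod (𝓡 2)) (𝓡 2) ∞ (fun z : ℝ × S2 => diffeo z.1 z.2)
  zero : ∀ p, diffeo 0 p = p

/-- Two diagrams differ by an isotopy of the sphere (and a reparametrization). -/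
def Isotopic (L L' : LinkoidDiagram n m) : Prop :=
  ∃ (Φ : SphereIsotopy) (φ : Src n m ≃ₜ Src n m), IsReparam φ ∧
    (∀ x, L'.toFun x = Φ.diffeo 1 (L.toFun (φ x))) ∧
    ∀ x, x ∈ L'.under ↔ φ x ∈ L.under

/-- The open disc that is the image of an open hemisphere under a diffeomorphism of the sphere. -/
def disc (Ψ : Diffeomorph (𝓡 2) (𝓡 2) S2 S2 ∞) : Set S2 :=
  Ψ '' {p : S2 | 0 < (p : E3) 2}

/-- The diagrams `L` and `L'` agree outside an open disc. Both meet the disc in `k` strands, which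
run between distinct points of its boundary and contain no end of an open component; the `r`-th
strand consists of the points at times `0 < s < len r` after `start r`. -/
structure LocalChange (L L' : LinkoidDiagram n m) (k : ℕ) where
  chart : Diffeomorph (𝓡 2) (𝓡 2) S2 S2 ∞
  start : Fin k → Src n m
  len : Fin k → ℝ
  len_pos : ∀ r, 0 < len r
  injective : ∀ r r' s s', s ∈ Icc 0 (len r) → s' ∈ Icc 0 (len r') →
    (start r).flow s = (start r').flow s' → r = r' ∧ s = s'
  not_end : ∀ r, ∀ s ∈ Icc 0 (len r), ¬ ((start r).flow s).IsEnd
  preimage : ∀ x, L.toFun x ∈ disc chart ↔ ∃ r, ∃ s ∈ Ioo 0 (len r), x = (start r).flow s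
  preimage' : ∀ x, L'.toFun x ∈ disc chart ↔ ∃ r, ∃ s ∈ Ioo 0 (len r), x = (start r).flow s
  boundary : ∀ x y, L.toFun x ∈ frontier (disc chart) → L.toFun x = L.toFun y → x = y
  agree : ∀ x, L.toFun x ∉ disc chart → L'.toFun x = L.toFun x
  agree_under : ∀ x, L.toFun x ∉ disc chart → (x ∈ L'.under ↔ x ∈ L.under)

namespace LocalChange

variable {L L' : LinkoidDiagram n m} {k : ℕ}

/-- The point at time `c.2` on the strand `c.1`. -/
def point (W : LocalChange L L' k) (c : Fin k × ℝ) : Src n m := (W.start c.1).flow c.2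

/-- The crossings of a diagram `K` inside the disc, as pairs of an over- and an under-position. -/
def crossings (W : LocalChange L L' k) (K : LinkoidDiagram n m) :
    Set ((Fin k × ℝ) × (Fin k × ℝ)) :=
  {c | c.1.2 ∈ Ioo 0 (W.len c.1.1) ∧ c.2.2 ∈ Ioo 0 (W.len c.2.1) ∧
    K.IsCrossing (W.point c.1) (W.point c.2)}

/-- The sign of a crossing in the disc. -/
def Pos (W : LocalChange L L' k) (K : LinkoidDiagram n m) (p q : Fin k × ℝ) : Prop :=
  K.IsPositive (W.point p) (W.point q)

end LocalChange

/-- First Reidemeister move: a strand with exactly one self-crossing (a kink) is replaced by a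
strand without crossing. -/
def ReidemeisterI (L L' : LinkoidDiagram n m) : Prop :=
  ∃ (W : LocalChange L L' 1) (p q : Fin 1 × ℝ),
    W.crossings L = {(p, q)} ∧ W.crossings L' = ∅

/-- Second Reidemeister move: two strands, the first of which passes over the second in two
crossings, of opposite signs, are pulled apart. -/
def ReidemeisterII (L L' : LinkoidDiagram n m) : Prop :=
  ∃ (W : LocalChange L L' 2) (a₁ a₂ b₁ b₂ : ℝ),
    W.crossings L = {((0, a₁), (1, b₁)), ((0, a₂), (1, b₂))} ∧
    (W.Pos L (0, a₁) (1, b₁) ↔ ¬ W.Pos L (0, a₂) (1, b₂)) ∧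
    W.crossings L' = ∅

/-- Third Reidemeister move: three strands, a top strand `0`, a middle strand `1` and a bottom
strand `2`, cross pairwise once, with the same signs before and after the move. The crossing of the
middle and the bottom strand is moved from the left to the right of the top strand. (As the sign
of a crossing tells in which direction the lower strand passes the upper one, a point of the lower
strand is to the left of the upper one exactly when it comes after a positive or before a negative
crossing.) -/
def ReidemeisterIII (L L' : LinkoidDiagram n m) : Prop :=
  ∃ (W : LocalChange L L' 3) (a₁ a₂ b₁ b₃ c₂ c₃ a₁' a₂' b₁' b₃' c₂' c₃' : ℝ),
    W.crossings L = {((0, a₁), (1, b₁)), ((0, a₂), (2, c₂)), ((1, b₃), (2, c₃))} ∧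
    W.crossings L' = {((0, a₁'), (1, b₁')), ((0, a₂'), (2, c₂')), ((1, b₃'), (2, c₃'))} ∧
    (W.Pos L (0, a₁) (1, b₁) ↔ W.Pos L' (0, a₁') (1, b₁')) ∧
    (W.Pos L (0, a₂) (2, c₂) ↔ W.Pos L' (0, a₂') (2, c₂')) ∧
    (W.Pos L (1, b₃) (2, c₃) ↔ W.Pos L' (1, b₃') (2, c₃')) ∧
    (b₁ < b₃ ↔ W.Pos L (0, a₁) (1, b₁)) ∧ (c₂ < c₃ ↔ W.Pos L (0, a₂) (2, c₂)) ∧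
    (b₃' < b₁' ↔ W.Pos L' (0, a₁') (1, b₁')) ∧ (c₃' < c₂' ↔ W.Pos L' (0, a₂') (2, c₂'))

/-- One isotopy or Reidemeister move. -/
def Move (L L' : LinkoidDiagram n m) : Prop :=
  Isotopic L L' ∨ ReidemeisterI L L' ∨ ReidemeisterII L L' ∨ ReidemeisterIII L L'

/-- Equivalence of diagrams; the classes are the oriented ordered `n`-linkoids (with `m` closed
components, a number that no move changes). -/
def Equivalent (L L' : LinkoidDiagram n m) : Prop := Relation.EqvGen Move L L'

end LinkoidDiagram

/-! ### Coloring quivers and their in-degree polynomials -/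

/-- A directed multigraph with `w a b` edges from `a` to `b`. -/
structure DirectedMultigraph where
  V : Type u
  w : V → V → ℕ

namespace DirectedMultigraph

/-- The number of edges into a vertex. -/
def inDegree (G : DirectedMultigraph.{u}) (b : G.V) : ℕ := ∑ᶠ a : G.V, G.w a b

/-- The polynomial `∑ u ^ deg⁺ b` over the vertices `b` of a finite directed multigraph. -/
def inDegreePolynomial (G : DirectedMultigraph.{u}) : Polynomial ℤ :=
  ∑ᶠ b : G.V, (Polynomial.X : Polynomial ℤ) ^ G.inDegree b

end DirectedMultigraph

variable {n m : ℕ}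

/-- The pointed quandle coloring quiver: the vertices are the colorings, with one edge from `α` to
`φ ∘ α` for each `φ ∈ S`. -/
def coloringQuiver (L : LinkoidDiagram n m) (P : PointedQuandle.{u} (2 * n))
    (S : Set (PointedHom P P)) : DirectedMultigraph.{u} where
  V := PointedHom L.fundamentalPointedQuandle P
  w α β := {φ : PointedHom P P | φ ∈ S ∧ φ.comp α = β}.ncard

/-- The in-degree quiver polynomial. -/
def quiverPolynomial (L : LinkoidDiagram n m) (P : PointedQuandle.{u} (2 * n))
    (S : Set (PointedHom P P)) : Polynomial ℤ :=
  (coloringQuiver L P S).inDegreePolynomial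

/-- The `2`-pointed quandle `(X, a, b)`. -/
def twoPointed (X : Type u) [Quandle X] (a b : X) : PointedQuandle.{u} (2 * 1) where
  carrier := X
  pt := ![a, b]

/-- The in-degree quiver polynomial matrix of a `1`-linkoid diagram with respect to a quandle with
the elements `x 0, …, x (k - 1)`. -/
def quiverPolynomialMatrix (L : LinkoidDiagram 1 m) {X : Type u} [Quandle X] {k : ℕ}
    (x : Fin k ≃ X)
    (S : ∀ i j, Set (PointedHom (twoPointed X (x i) (x j)) (twoPointed X (x i) (x j)))) :
    Matrix (Fin k) (Fin k) (Polynomial ℤ) :=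
  Matrix.of fun i j => quiverPolynomial L (twoPointed X (x i) (x j)) (S i j)

end LinkoidTheory

end

open LinkoidTheory

namespace LinkoidTheory

open scoped Quandles

/-! A homomorphism from the fundamental quandle to `X` is a coloring, and a coloring can be
described without arcs: it is a function from the source of the diagram to `X` that is locally
constant away from the undercrossings, has the arriving color at an undercrossing, and changes there
by `x ◃ ·` or `x ◃⁻¹ ·` according to the sign, where `x` is the color of the upper point
(`IsColoring`, `pointedHomEquiv`). Diagrams related by a move have the same source, so their
colorings can be compared point by point.

It suffices to find, for each move, a bijection of the pointed colorings that commutes with the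
endomorphisms of the pointed quandle. It is then an isomorphism of coloring quivers, so the
in-degree polynomials agree (`ColoringsCorrespond.quiverPolynomial_eq`).

For an isotopy the bijection is composition with the reparametrization. The signs of the crossings
survive because the triple product of the position and the two velocities depends continuously on
the time of the isotopy and never vanishes.

For a Reidemeister move, the colors at the starts of the strands in the disc extend uniquely along
the strands, before and after the move (`IsSolution`). If both extensions arrive at the same colors,
each coloring of one diagram can be changed inside the disc, in a unique way, to a coloring of the
other (`IsSolution.colorings_correspond`); uniqueness gives the compatibility with endomorphisms.
Equality of the final colors is idempotence for move I, invertibility for move II and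
self-distributivity for move III.

Finiteness of the set of colorings holds because a diagram has finitely many arcs, by compactness of
the source. -/

/-- Only `◃` is preserved by definition; `◃⁻¹` follows by cancelling the bijection `φ x ◃ ·`. -/
theorem ShelfHom.map_invAct {X Y : Type*} [Rack X] [Rack Y] (φ : ShelfHom X Y) (x y : X) :
    φ (x ◃⁻¹ y) = φ x ◃⁻¹ φ y := by
  rw [← Rack.left_inv (φ x) (φ (x ◃⁻¹ y)), ← φ.map_act, Rack.right_inv x y]

/-! ### Homomorphisms out of a presented quandle -/

namespace PresentedQuandle

variable {α : Type u} {X : Type v} [Quandle X]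

/-- The value of a formal expression at an assignment of the generators. -/
def eval (g : α → X) : QuandleTerm α → X
  | .gen a => g a
  | .act x y => eval g x ◃ eval g y
  | .invAct x y => eval g x ◃⁻¹ eval g y

theorem eval_eq_of_rel {r : QuandleTerm α → QuandleTerm α → Prop} {g : α → X}
    (h : ∀ x y, r x y → eval g x = eval g y) {x y : QuandleTerm α}
    (hxy : QuandleTerm.Rel r x y) : eval g x = eval g y := by
  induction hxy with
  | of h' => exact h _ _ h'
  | refl x => rfl
  | symm _ ih => exact ih.symm
  | trans _ _ ih ih' => exact ih.trans ih'
  | act_congr _ _ ih ih' => simp only [eval, ih, ih']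
  | invAct_congr _ _ ih ih' => simp only [eval, ih, ih']
  | self_distrib x y z => exact Shelf.self_distrib
  | left_inv x y => exact Rack.left_inv _ _
  | right_inv x y => exact Rack.right_inv _ _
  | fix x => exact Quandle.fix

/-- The homomorphism out of a presented quandle with given values at the generators. -/
def lift {r : QuandleTerm α → QuandleTerm α → Prop} (g : α → X)
    (h : ∀ x y, r x y → eval g x = eval g y) : ShelfHom (PresentedQuandle r) X where
  toFun := Quotient.lift (eval g) fun _ _ hxy => eval_eq_of_rel h hxy
  map_act' := by
    rintro ⟨x⟩ ⟨y⟩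
    rfl

theorem lift_of {r : QuandleTerm α → QuandleTerm α → Prop} (g : α → X)
    (h : ∀ x y, r x y → eval g x = eval g y) (a : α) : lift g h (of r a) = g a := rfl

theorem hom_mk {r : QuandleTerm α → QuandleTerm α → Prop} (φ : ShelfHom (PresentedQuandle r) X)
    (t : QuandleTerm α) :
    φ (Quotient.mk (QuandleTerm.setoid r) t) = eval (fun a => φ (of r a)) t := by
  induction t with
  | gen a => rfl
  | act x y ihx ihy =>
    rw [eval, ← ihx, ← ihy]
    exact φ.map_act (x := Quotient.mk (QuandleTerm.setoid r) x)
      (y := Quotient.mk (QuandleTerm.setoid r) y)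
  | invAct x y ihx ihy =>
    rw [eval, ← ihx, ← ihy]
    exact ShelfHom.map_invAct φ (Quotient.mk (QuandleTerm.setoid r) x)
      (Quotient.mk (QuandleTerm.setoid r) y)

theorem hom_ext {r : QuandleTerm α → QuandleTerm α → Prop}
    {φ ψ : ShelfHom (PresentedQuandle r) X} (h : ∀ a, φ (of r a) = ψ (of r a)) : φ = ψ := by
  ext x
  obtain ⟨t, rfl⟩ := Quotient.exists_rep x
  change φ _ = ψ _
  rw [hom_mk, hom_mk, funext h]

/-- Converse to `lift`: the images of the generators under any homomorphism satisfy the defining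
relations. -/
theorem eval_eq_of_hom {r : QuandleTerm α → QuandleTerm α → Prop}
    (φ : ShelfHom (PresentedQuandle r) X) {x y : QuandleTerm α} (hxy : r x y) :
    eval (fun a => φ (of r a)) x = eval (fun a => φ (of r a)) y := by
  rw [← hom_mk, ← hom_mk, Quotient.sound (s := QuandleTerm.setoid r) (QuandleTerm.Rel.of hxy)]

end PresentedQuandle

/-! ### From corresponding colorings to equal polynomials -/

namespace LinkoidDiagram

variable {n m : ℕ}

/-- The colorings of two diagrams correspond to each other, compatibly with the action of the
endomorphisms of the coloring quandle. -/
def ColoringsCorrespond (P : PointedQuandle.{u} (2 * n)) (L L' : LinkoidDiagram n m) : Prop :=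
  ∃ e : PointedHom L.fundamentalPointedQuandle P ≃ PointedHom L'.fundamentalPointedQuandle P,
    ∀ (φ : PointedHom P P) α, e (φ.comp α) = φ.comp (e α)

theorem ColoringsCorrespond.refl (P : PointedQuandle.{u} (2 * n)) (L : LinkoidDiagram n m) :
    ColoringsCorrespond P L L := ⟨Equiv.refl _, fun _ _ => rfl⟩

theorem ColoringsCorrespond.symm {P : PointedQuandle.{u} (2 * n)} {L L' : LinkoidDiagram n m} :
    ColoringsCorrespond P L L' → ColoringsCorrespond P L' L := by
  rintro ⟨e, he⟩
  refine ⟨e.symm, fun φ α => ?_⟩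
  rw [Equiv.symm_apply_eq, he, Equiv.apply_symm_apply]

theorem ColoringsCorrespond.trans {P : PointedQuandle.{u} (2 * n)} {L L' L'' : LinkoidDiagram n m} :
    ColoringsCorrespond P L L' → ColoringsCorrespond P L' L'' → ColoringsCorrespond P L L'' := by
  rintro ⟨e, he⟩ ⟨e', he'⟩
  exact ⟨e.trans e', fun φ α => by simp only [Equiv.trans_apply, he, he']⟩

/-- Since `e` is injective and commutes with each `φ`, the same `φ ∈ S` give edges from `α` to `β`
and from `e α` to `e β`; hence in-degrees match, and so do the sums over vertices. -/
theorem ColoringsCorrespond.quiverPolynomial_eq {P : PointedQuandle.{u} (2 * n)}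
    {L L' : LinkoidDiagram n m} (h : ColoringsCorrespond P L L') (S : Set (PointedHom P P)) :
    quiverPolynomial L P S = quiverPolynomial L' P S := by
  obtain ⟨e, he⟩ := h
  have hw : ∀ α β : PointedHom L.fundamentalPointedQuandle P,
      (coloringQuiver L P S).w α β = (coloringQuiver L' P S).w (e α) (e β) := by
    intro α β
    simp only [coloringQuiver]
    congr 1
    ext φ
    exact and_congr_right fun _ => (e.injective.eq_iff.symm.trans (by rw [he]))
  have hd : ∀ β, (coloringQuiver L P S).inDegree β = (coloringQuiver L' P S).inDegree (e β) :=
    fun β => finsum_eq_of_bijective e e.bijective fun α => hw α β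
  exact finsum_eq_of_bijective e e.bijective fun β => by rw [hd]

end LinkoidDiagram

/-! ### Motion along the components of the source -/

namespace Src

variable {n m : ℕ}

theorem flow_zero (x : Src n m) : x.flow 0 = x := by
  rcases x with ⟨i, t⟩ | ⟨j, θ⟩
  · simp [flow, projIcc_val]
  · simp [flow]

theorem zero_mem_reach (x : Src n m) : (0 : ℝ) ∈ x.reach := by
  rcases x with ⟨i, t⟩ | ⟨j, θ⟩
  · simpa only [reach, mem_ofPred_eq, add_zero] using t.2
  · trivial

/-- The hypothesis on `a` excludes that the first motion is stopped at an end of an interval, where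
the excess time would be lost. -/
theorem flow_flow {x : Src n m} {a : ℝ} (ha : a ∈ x.reach) (b : ℝ) :
    (x.flow a).flow b = x.flow (a + b) := by
  rcases x with ⟨i, t⟩ | ⟨j, θ⟩
  · simp only [flow, projIcc_of_mem zero_le_one ha, add_assoc]
  · simp only [flow, AddCircle.coe_add, add_assoc]

theorem continuous_flow (x : Src n m) : Continuous x.flow := by
  rcases x with ⟨i, t⟩ | ⟨j, θ⟩
  · exact continuous_inl.comp (continuous_const.prodMk
      (continuous_projIcc.comp (continuous_const.add continuous_id)))
  · exact continuous_inr.comp (continuous_const.prodMk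
      (continuous_const.add (AddCircle.continuous_mk' 1)))

theorem reach_mem_nhds {x : Src n m} (hx : ¬ x.IsEnd) : x.reach ∈ 𝓝 (0 : ℝ) := by
  rcases x with ⟨i, t⟩ | ⟨j, θ⟩
  · have h0 : (t : ℝ) ≠ 0 := fun h => hx ⟨i, Or.inl (by rw [leg]; congr 2; exact Subtype.ext h)⟩
    have h1 : (t : ℝ) ≠ 1 := fun h => hx ⟨i, Or.inr (by rw [head]; congr 2; exact Subtype.ext h)⟩
    have h0' := lt_of_le_of_ne t.2.1 h0.symm
    have h1' := lt_of_le_of_ne t.2.2 h1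
    filter_upwards [Ioo_mem_nhds (neg_lt_zero.2 h0') (sub_pos.2 h1')] with s hs
    exact ⟨by linarith [hs.1], by linarith [hs.2]⟩
  · exact univ_mem

/-- The points near `x` are those that are reached from `x` in a short time. -/
theorem eventually_exists_flow (x : Src n m) {U : Set ℝ} (hU : U ∈ 𝓝 (0 : ℝ)) :
    ∀ᶠ y in 𝓝 x, ∃ s ∈ U ∩ x.reach, x.flow s = y := by
  rcases x with ⟨i, t⟩ | ⟨j, θ⟩
  · rw [nhds_inl, eventually_map, nhds_prod_eq, nhds_discrete, pure_prod, eventually_map]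
    have h : Tendsto (fun t' : unitInterval => (t' : ℝ) - t) (𝓝 t) (𝓝 0) := by
      have : Continuous fun t' : unitInterval => (t' : ℝ) - t := by fun_prop
      simpa using this.tendsto t
    filter_upwards [h hU] with t' ht'
    refine ⟨(t' : ℝ) - t, ⟨ht', by simpa only [reach, mem_ofPred_eq, add_sub_cancel] using t'.2⟩, ?_⟩
    simp [flow, projIcc_val]
  · rw [nhds_inr, eventually_map, nhds_prod_eq, nhds_discrete, pure_prod, eventually_map]
    have h : (fun s : ℝ => θ + (s : UnitAddCircle)) '' U ∈ 𝓝 θ := by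
      have ho : IsOpenMap fun s : ℝ => θ + (s : UnitAddCircle) :=
        (isOpenMap_add_left θ).comp QuotientAddGroup.isOpenMap_coe
      simpa using ho.image_mem_nhds hU
    filter_upwards [h] with θ' hθ'
    obtain ⟨s, hs, rfl⟩ := hθ'
    exact ⟨s, ⟨hs, trivial⟩, rfl⟩

/-- This turns topological statements on the source into statements about one real variable, the
form in which smoothness of a diagram is given. -/
theorem nhds_eq_map_flow (x : Src n m) : 𝓝 x = map x.flow (𝓝[x.reach] 0) := by
  refine le_antisymm (fun V hV => ?_) ?_
  · rw [mem_map, mem_nhdsWithin_iff_exists_mem_nhds_inter] at hV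
    obtain ⟨U, hU, hUV⟩ := hV
    filter_upwards [eventually_exists_flow x hU]
    rintro y ⟨s, hs, rfl⟩
    exact hUV hs
  · have h := x.continuous_flow.tendsto 0
    rw [flow_zero] at h
    exact h.mono_left nhdsWithin_le_nhds

theorem tendsto_flow_zero (x : Src n m) : Tendsto x.flow (𝓝 0) (𝓝 x) := by
  simpa only [flow_zero] using x.continuous_flow.tendsto 0

/-- A short motion from a point in the interior of a component changes the point. -/
theorem eventually_flow_ne {x : Src n m} (hx : ¬ x.IsEnd) : ∀ᶠ s in 𝓝[≠] (0 : ℝ), x.flow s ≠ x := by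
  have h1 : ∀ᶠ s in 𝓝[≠] (0 : ℝ), s ∈ x.reach := nhdsWithin_le_nhds (reach_mem_nhds hx)
  have h2 : ∀ᶠ s in 𝓝[≠] (0 : ℝ), s ∈ Ioo (-1 : ℝ) 1 :=
    nhdsWithin_le_nhds (Ioo_mem_nhds (by norm_num) (by norm_num))
  filter_upwards [h1, h2, self_mem_nhdsWithin] with s hs hs1 hs0 h
  rcases x with ⟨i, t⟩ | ⟨j, θ⟩
  · simp only [flow, projIcc_of_mem zero_le_one hs] at h
    have h' := congrArg Subtype.val (Prod.ext_iff.1 (Sum.inl_injective h)).2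
    simp only [add_eq_left] at h'
    exact hs0 h'
  · simp only [flow] at h
    have h' := (Prod.ext_iff.1 (Sum.inr_injective h)).2
    simp only [add_eq_left] at h'
    obtain ⟨k, hk⟩ := (AddCircle.coe_eq_zero_iff (p := (1 : ℝ))).1 h'
    rw [zsmul_eq_mul, mul_one] at hk
    subst hk
    have hk1 : (-1 : ℤ) < k := by exact_mod_cast hs1.1
    have hk2 : k < 1 := by exact_mod_cast hs1.2
    have : k = 0 := by omega
    exact hs0 (by simp [this])

theorem eventually_flow_notMem {x : Src n m} (hx : ¬ x.IsEnd) {S : Set (Src n m)} (hS : S.Finite) :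
    ∀ᶠ s in 𝓝[≠] (0 : ℝ), x.flow s ∉ S := by
  -- The point `x` may itself belong to `S`; it is avoided separately, because a short nonzero
  -- motion leaves it.
  have h1 : ∀ᶠ y in 𝓝 x, y ∉ S \ {x} :=
    (hS.subset sdiff_subset).isClosed.isOpen_compl.mem_nhds (by simp)
  have h2 : ∀ᶠ s in 𝓝[≠] (0 : ℝ), x.flow s ∉ S \ {x} :=
    nhdsWithin_le_nhds ((tendsto_flow_zero x).eventually h1)
  filter_upwards [h2, eventually_flow_ne hx] with s hs hs' h
  exact hs ⟨h, hs'⟩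

end Src

/-! ### Crossings, and the arcs near a point -/

namespace LinkoidDiagram

variable {n m : ℕ} (L : LinkoidDiagram n m)

theorem finite_under : L.under.Finite := L.finite_double.subset L.double_of_under

theorem continuous_toFun : Continuous L.toFun := by
  refine continuous_iff_continuousAt.2 fun x => ?_
  rw [Topology.IsInducing.subtypeVal.continuousAt_iff, ContinuousAt, Src.nhds_eq_map_flow,
    tendsto_map'_iff]
  have h := (L.smooth x).continuousOn.continuousWithinAt x.zero_mem_reach
  simp only [ContinuousWithinAt, Src.flow_zero] at h
  exact h

theorem not_isEnd_of_under {x : Src n m} (hx : x ∈ L.under) : ¬ x.IsEnd :=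
  fun h => L.not_under_of_isEnd h hx

variable {L}

theorem IsCrossing.over_notMem {p q : Src n m} (h : L.IsCrossing p q) : p ∉ L.under := fun hp =>
  (L.under_iff p q h.1 h.2.1).1 hp h.2.2

theorem exists_isCrossing {q : Src n m} (hq : q ∈ L.under) : ∃ p, L.IsCrossing p q := by
  obtain ⟨p, hne, he⟩ := L.double_of_under q hq
  exact ⟨p, hne.symm, he.symm, hq⟩

theorem IsCrossing.over_unique {p p' q : Src n m} (h : L.IsCrossing p q) (h' : L.IsCrossing p' q) :
    p = p' := by
  rcases L.no_triple p q p' h.2.1 h'.2.1.symm with h1 | h1 | h1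
  · exact absurd h1 h.1
  · exact absurd h1.symm h'.1
  · exact h1

/-- Away from the ends `reach` is a neighborhood of `0`, so the derivative within it is an ordinary
one. -/
theorem hasDerivAt_flow {x : Src n m} (hx : ¬ x.IsEnd) :
    HasDerivAt (fun s => (L.toFun (x.flow s) : E3)) (velocity L.toFun x) 0 := by
  have h := ((L.smooth x).differentiableOn (by simp) 0 x.zero_mem_reach).hasDerivWithinAt
  exact h.hasDerivAt (Src.reach_mem_nhds hx)

/-- The path from one point to the other is the continuous image of an interval and avoids the
undercrossings, so it stays in one connected component. -/
theorem arc_flow_eq {x : Src n m} {s t : ℝ} (h : ∀ r ∈ uIcc s t, x.flow r ∉ L.under) :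
    L.arc (x.flow s) (h s left_mem_uIcc) = L.arc (x.flow t) (h t right_mem_uIcc) := by
  refine ConnectedComponents.coe_eq_coe'.2 ?_
  let f : uIcc s t → {y : Src n m // y ∉ L.under} := fun r => ⟨x.flow r, h r r.2⟩
  have hf : Continuous f := (x.continuous_flow.comp continuous_subtype_val).subtype_mk _
  have hp : IsPreconnected (range f) := by
    have : PreconnectedSpace (uIcc s t) := Subtype.preconnectedSpace isPreconnected_uIcc
    exact isPreconnected_range hf
  exact hp.subset_connectedComponent (x := ⟨x.flow t, _⟩) ⟨⟨t, right_mem_uIcc⟩, rfl⟩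
    ⟨⟨s, left_mem_uIcc⟩, rfl⟩

/-- There are finitely many undercrossings, so a short path arriving at `q` meets none before `q`
and lies in a single arc. -/
theorem exists_isIncoming {q : Src n m} (hq : q ∈ L.under) : ∃ a, L.IsIncoming q a := by
  have h := Src.eventually_flow_notMem (L.not_isEnd_of_under hq) L.finite_under
  have h' : ∀ᶠ s in 𝓝[<] (0 : ℝ), q.flow s ∉ L.under := nhdsWithin_mono _ (fun s hs => ne_of_lt hs) h
  obtain ⟨l, hl, hl'⟩ := (mem_nhdsLT_iff_exists_Ioo_subset).1 h'
  obtain ⟨c, hc⟩ := exists_between (mem_Iio.1 hl)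
  refine ⟨L.arc (q.flow c) (hl' hc), ?_⟩
  filter_upwards [Ioo_mem_nhdsLT (mem_Iio.1 hl)] with s hs
  exact ⟨hl' hs, arc_flow_eq fun r hr => hl' (ordConnected_Ioo.uIcc_subset hs hc hr)⟩

theorem exists_isOutgoing {q : Src n m} (hq : q ∈ L.under) : ∃ a, L.IsOutgoing q a := by
  have h := Src.eventually_flow_notMem (L.not_isEnd_of_under hq) L.finite_under
  have h' : ∀ᶠ s in 𝓝[>] (0 : ℝ), q.flow s ∉ L.under := nhdsWithin_mono _ (fun s hs => ne_of_gt hs) h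
  obtain ⟨l, hl, hl'⟩ := (mem_nhdsGT_iff_exists_Ioo_subset).1 h'
  obtain ⟨c, hc⟩ := exists_between (mem_Ioi.1 hl)
  refine ⟨L.arc (q.flow c) (hl' hc), ?_⟩
  filter_upwards [Ioo_mem_nhdsGT (mem_Ioi.1 hl)] with s hs
  exact ⟨hl' hs, arc_flow_eq fun r hr => hl' (ordConnected_Ioo.uIcc_subset hs hc hr)⟩

/-- The points near a point off the undercrossings belong to its arc. -/
theorem eventually_arc_eq {x : Src n m} (hx : x ∉ L.under) :
    ∀ᶠ y in 𝓝 x, ∃ h : y ∉ L.under, L.arc y h = L.arc x hx := by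
  have h1 : ∀ᶠ y in 𝓝 x, y ∉ L.under := L.finite_under.isClosed.isOpen_compl.mem_nhds hx
  have h2 := (Src.tendsto_flow_zero x).eventually h1
  obtain ⟨ε, hε, hε'⟩ := Metric.eventually_nhds_iff_ball.1 h2
  filter_upwards [Src.eventually_exists_flow x (Metric.ball_mem_nhds 0 hε)]
  rintro y ⟨s, hs, rfl⟩
  have h0 : (0 : ℝ) ∈ Metric.ball 0 ε := Metric.mem_ball_self hε
  have hc : (Metric.ball (0 : ℝ) ε).OrdConnected := (convex_ball 0 ε).ordConnected
  refine ⟨hε' s hs.1, ?_⟩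
  have h3 := arc_flow_eq (L := L) (x := x) (s := s) (t := 0)
    fun r hr => hε' r (hc.uIcc_subset hs.1 h0 hr)
  rw [h3]
  congr 1
  exact x.flow_zero

/-- Each point has a neighborhood that meets at most two arcs: the arriving and the leaving one at
an undercrossing, a single one elsewhere. Compactness of the source does the rest. -/
theorem finite_arc (L : LinkoidDiagram n m) : Finite L.Arc := by
  have key : ∀ K : Set (Src n m), IsCompact K →
      {a : L.Arc | ∃ y ∈ K, ∃ h : y ∉ L.under, L.arc y h = a}.Finite := by
    intro K hK
    refine hK.induction_on ?_ ?_ ?_ ?_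
    · simp
    · intro s t hst ht
      exact ht.subset fun a ⟨y, hy, h⟩ => ⟨y, hst hy, h⟩
    · intro s t hs ht
      refine (hs.union ht).subset ?_
      rintro a ⟨y, hy | hy, h⟩
      · exact Or.inl ⟨y, hy, h⟩
      · exact Or.inr ⟨y, hy, h⟩
    · intro x _
      by_cases hx : x ∈ L.under
      · obtain ⟨a, ha⟩ := exists_isIncoming hx
        obtain ⟨b, hb⟩ := exists_isOutgoing hx
        obtain ⟨U, hU, hU'⟩ := mem_nhdsWithin_iff_exists_mem_nhds_inter.1 ha
        obtain ⟨V, hV, hV'⟩ := mem_nhdsWithin_iff_exists_mem_nhds_inter.1 hb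
        refine ⟨_, nhdsWithin_le_nhds (Src.eventually_exists_flow x (inter_mem hU hV)),
          (toFinite {a, b}).subset ?_⟩
        rintro c ⟨y, ⟨s, hs, rfl⟩, h, rfl⟩
        rcases lt_trichotomy s 0 with h0 | rfl | h0
        · obtain ⟨h1, h2⟩ := hU' ⟨hs.1.1, h0⟩
          exact Or.inl h2
        · exact absurd hx (by simpa only [Src.flow_zero] using h)
        · obtain ⟨h1, h2⟩ := hV' ⟨hs.1.2, h0⟩
          exact Or.inr h2
      · refine ⟨_, nhdsWithin_le_nhds (eventually_arc_eq hx), (toFinite {L.arc x hx}).subset ?_⟩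
        rintro c ⟨y, ⟨h, h'⟩, _, rfl⟩
        exact h'
  refine finite_univ_iff.1 ((key univ isCompact_univ).subset fun a _ => ?_)
  obtain ⟨⟨y, hy⟩, rfl⟩ := ConnectedComponents.surjective_coe a
  exact ⟨y, trivial, hy, rfl⟩

end LinkoidDiagram

/-! ### Colorings as functions on the source -/

noncomputable section

namespace LinkoidDiagram

variable {n m : ℕ} {X : Type v} [Quandle X]

open Classical in
/-- The color `y` of the lower strand after the crossing with over-preimage `p` and under-preimage
`q`, where the upper strand has the color `x`. -/
def crossAct (L : LinkoidDiagram n m) (p q : Src n m) (x y : X) : X :=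
  if L.IsPositive p q then x ◃ y else x ◃⁻¹ y

theorem crossAct_congr {L L' : LinkoidDiagram n m} {p q p' q' : Src n m}
    (h : L.IsPositive p q ↔ L'.IsPositive p' q') (x y : X) :
    L.crossAct p q x y = L'.crossAct p' q' x y := by
  by_cases hp : L.IsPositive p q
  · rw [crossAct, crossAct, if_pos hp, if_pos (h.1 hp)]
  · rw [crossAct, crossAct, if_neg hp, if_neg (mt h.2 hp)]

theorem map_crossAct {Y : Type*} [Quandle Y] (φ : ShelfHom X Y) (L : LinkoidDiagram n m)
    (p q : Src n m) (x y : X) : φ (L.crossAct p q x y) = L.crossAct p q (φ x) (φ y) := by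
  unfold crossAct
  split_ifs
  · exact φ.map_act
  · exact ShelfHom.map_invAct φ x y

/-- The conditions at the point `x` for a function `f` to be a coloring. At an undercrossing `f`
has the color of the arriving arc. -/
structure IsColoringAt (L : LinkoidDiagram n m) (f : Src n m → X) (x : Src n m) : Prop where
  const : x ∉ L.under → ∀ᶠ y in 𝓝 x, f y = f x
  left : x ∈ L.under → ∀ᶠ s in 𝓝[<] (0 : ℝ), f (x.flow s) = f x
  right : ∀ p, L.IsCrossing p x →
    ∀ᶠ s in 𝓝[>] (0 : ℝ), f (x.flow s) = L.crossAct p x (f p) (f x)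

/-- The colorings of a diagram by the elements of a quandle. -/
def IsColoring (L : LinkoidDiagram n m) (f : Src n m → X) : Prop := ∀ x, L.IsColoringAt f x

theorem IsColoring.map {Y : Type*} [Quandle Y] (φ : ShelfHom X Y) {L : LinkoidDiagram n m}
    {f : Src n m → X} (hf : L.IsColoring f) : L.IsColoring fun x => φ (f x) := fun x =>
  { const := fun hx => ((hf x).const hx).mono fun _ hy => congrArg φ hy
    left := fun hx => ((hf x).left hx).mono fun _ hy => congrArg φ hy
    right := fun p hp => ((hf x).right p hp).mono fun _ hy => by rw [hy, map_crossAct] }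

/-- The ends of the open components, in the order of the basepoints. -/
def basepoint (j : Fin (2 * n)) : Src n m :=
  if (j : ℕ) % 2 = 0 then Src.leg ⟨(j : ℕ) / 2, by omega⟩ else Src.head ⟨(j : ℕ) / 2, by omega⟩

theorem isEnd_basepoint (j : Fin (2 * n)) : (basepoint j : Src n m).IsEnd := by
  unfold basepoint
  split_ifs
  · exact ⟨_, Or.inl rfl⟩
  · exact ⟨_, Or.inr rfl⟩

open Classical in
/-- The arc through a point, which is the arriving arc at an undercrossing. -/
def arcAt (L : LinkoidDiagram n m) (x : Src n m) : L.Arc :=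
  if h : x ∈ L.under then (exists_isIncoming h).choose else L.arc x h

theorem arcAt_eq {L : LinkoidDiagram n m} {x : Src n m} (hx : x ∉ L.under) :
    L.arcAt x = L.arc x hx := dif_neg hx

theorem arcAt_isIncoming {L : LinkoidDiagram n m} {x : Src n m} (hx : x ∈ L.under) :
    L.IsIncoming x (L.arcAt x) := by
  rw [arcAt, dif_pos hx]
  exact (exists_isIncoming hx).choose_spec

theorem exists_arcAt_eq {L : LinkoidDiagram n m} (a : L.Arc) : ∃ x, L.arcAt x = a := by
  obtain ⟨⟨y, hy⟩, rfl⟩ := ConnectedComponents.surjective_coe a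
  exact ⟨y, arcAt_eq hy⟩

/-- The coloring that belongs to a homomorphism from the fundamental quandle. -/
def coloringOf {L : LinkoidDiagram n m} (α : ShelfHom L.FundamentalQuandle X) (x : Src n m) : X :=
  α (PresentedQuandle.of _ (L.arcAt x))

/-- Local constancy and the left limit express that nearby points lie on the same arc; the jump is
the crossing relation, which at a negative crossing has to be solved for the leaving color. -/
theorem isColoring_coloringOf {L : LinkoidDiagram n m} (α : ShelfHom L.FundamentalQuandle X) :
    L.IsColoring (coloringOf α) := by
  refine fun x => ⟨fun hx => ?_, fun hx => ?_, fun p hp => ?_⟩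
  · filter_upwards [eventually_arc_eq hx] with y ⟨hy, hy'⟩
    rw [coloringOf, coloringOf, arcAt_eq hx, arcAt_eq hy, hy']
  · filter_upwards [arcAt_isIncoming hx] with s ⟨hs, hs'⟩
    rw [coloringOf, coloringOf, arcAt_eq hs, hs']
  · obtain ⟨b, hb⟩ := exists_isOutgoing hp.2.2
    filter_upwards [hb] with s ⟨hs, hs'⟩
    rw [coloringOf, coloringOf, coloringOf, arcAt_eq hs, hs', arcAt_eq hp.over_notMem, crossAct]
    split_ifs with h
    · exact PresentedQuandle.eval_eq_of_hom α
        (.pos p x hp.over_notMem (L.arcAt x) b hp h (arcAt_isIncoming hp.2.2) hb)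
    · have h1 := PresentedQuandle.eval_eq_of_hom α
        (.neg p x hp.over_notMem (L.arcAt x) b hp h (arcAt_isIncoming hp.2.2) hb)
      simp only [PresentedQuandle.eval] at h1
      rw [h1]
      exact (Rack.left_inv _ _).symm

theorem coloringOf_injective {L : LinkoidDiagram n m} {α β : ShelfHom L.FundamentalQuandle X}
    (h : coloringOf α = coloringOf β) : α = β := by
  refine PresentedQuandle.hom_ext fun a => ?_
  obtain ⟨x, rfl⟩ := exists_arcAt_eq a
  exact congrFun h x

/-- Off the undercrossings `f` is locally constant, hence constant on connected components. -/
theorem IsColoring.eq_of_arc_eq {L : LinkoidDiagram n m} {f : Src n m → X} (hf : L.IsColoring f)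
    {x y : Src n m} {hx : x ∉ L.under} {hy : y ∉ L.under} (h : L.arc x hx = L.arc y hy) :
    f x = f y := by
  have hl : IsLocallyConstant fun z : {z : Src n m // z ∉ L.under} => f z := by
    rw [IsLocallyConstant.iff_eventually_eq]
    exact fun z => continuous_subtype_val.continuousAt.eventually ((hf z).const z.2)
  exact hl.apply_eq_of_isPreconnected isPreconnected_connectedComponent
    (ConnectedComponents.coe_eq_coe'.1 h) mem_connectedComponent

/-- Each arc receives the value of `f` at a chosen point of it. The crossing relations are verified
by evaluating `f` at a point just before or just after the undercrossing, which lies on the arriving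
or leaving arc and has the color that the coloring condition prescribes. -/
theorem IsColoring.exists_coloringOf_eq {L : LinkoidDiagram n m} {f : Src n m → X}
    (hf : L.IsColoring f) : ∃ α : ShelfHom L.FundamentalQuandle X, coloringOf α = f := by
  choose r hr using fun a : L.Arc => ConnectedComponents.surjective_coe a
  let g : L.Arc → X := fun a => f (r a)
  have hg : ∀ x hx, g (L.arc x hx) = f x := fun x hx => hf.eq_of_arc_eq (hx := (r _).2) (hr _)
  have hin : ∀ q a, q ∈ L.under → L.IsIncoming q a → g a = f q := by
    intro q a hq ha
    obtain ⟨s, ⟨hs, rfl⟩, hs'⟩ := (ha.and ((hf q).left hq)).exists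
    rw [hg, hs']
  have hout : ∀ p q b, L.IsCrossing p q → L.IsOutgoing q b →
      g b = L.crossAct p q (f p) (f q) := by
    intro p q b hp hb
    obtain ⟨s, ⟨hs, rfl⟩, hs'⟩ := (hb.and ((hf q).right p hp)).exists
    rw [hg, hs']
  refine ⟨PresentedQuandle.lift g ?_, ?_⟩
  · rintro x y (⟨p, q, hp, a, b, hc, hs, ha, hb⟩ | ⟨p, q, hp, a, b, hc, hs, ha, hb⟩)
    · simp only [PresentedQuandle.eval]
      rw [hout p q b hc hb, hin q a hc.2.2 ha, hg, crossAct, if_pos hs]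
    · simp only [PresentedQuandle.eval]
      rw [hout p q b hc hb, hin q a hc.2.2 ha, hg, crossAct, if_neg hs]
      exact (Rack.right_inv _ _).symm
  · ext x
    rw [coloringOf, PresentedQuandle.lift_of]
    by_cases hx : x ∈ L.under
    · exact hin x _ hx (arcAt_isIncoming hx)
    · rw [arcAt_eq hx, hg]

/-- The colorings with prescribed values at the ends of the open components. -/
def pointedColorings (L : LinkoidDiagram n m) (P : PointedQuandle.{u} (2 * n)) :
    Set (Src n m → P.carrier) :=
  {f | L.IsColoring f ∧ ∀ j, f (basepoint j) = P.pt j}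

theorem fundamentalPointedQuandle_pt (L : LinkoidDiagram n m) (j : Fin (2 * n)) :
    L.fundamentalPointedQuandle.pt j = PresentedQuandle.of L.CrossingRel (L.arcAt (basepoint j)) := by
  rw [arcAt_eq (L.not_under_of_isEnd (isEnd_basepoint j))]
  by_cases h : (j : ℕ) % 2 = 0
  · simp only [fundamentalPointedQuandle, basepoint, if_pos h, legLabel]
  · simp only [fundamentalPointedQuandle, basepoint, if_neg h, headLabel]

/-- The vertices of the coloring quiver are the pointed colorings. -/
def pointedHomEquiv (L : LinkoidDiagram n m) (P : PointedQuandle.{u} (2 * n)) :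
    PointedHom L.fundamentalPointedQuandle P ≃ L.pointedColorings P :=
  Equiv.ofBijective
    (fun α => ⟨coloringOf (L := L) α.hom, isColoring_coloringOf (L := L) α.hom, fun j => by
      rw [← α.map_pt, fundamentalPointedQuandle_pt]; rfl⟩) <| by
    constructor
    · intro α β h
      exact PointedHom.ext (coloringOf_injective (L := L) (congrArg Subtype.val h))
    · rintro ⟨f, hf, hj⟩
      obtain ⟨α, rfl⟩ := hf.exists_coloringOf_eq
      exact ⟨⟨α, fun j => by rw [fundamentalPointedQuandle_pt, ← hj j]; rfl⟩, rfl⟩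

/-- A homomorphism is determined by its values on the finitely many arcs. -/
theorem finite_pointedHom (L : LinkoidDiagram n m) (P : PointedQuandle.{u} (2 * n))
    [Finite P.carrier] : Finite (PointedHom L.fundamentalPointedQuandle P) := by
  have := L.finite_arc
  refine Finite.of_injective
    (fun (α : PointedHom L.fundamentalPointedQuandle P) (a : L.Arc) =>
      α.hom (PresentedQuandle.of L.CrossingRel a)) fun α β h => ?_
  exact PointedHom.ext (PresentedQuandle.hom_ext (r := L.CrossingRel) fun a => congrFun h a)

/-- A correspondence of pointed colorings that is compatible with endomorphisms. -/
theorem colorings_correspond_of_equiv {L L' : LinkoidDiagram n m} {P : PointedQuandle.{u} (2 * n)}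
    (e : L.pointedColorings P ≃ L'.pointedColorings P)
    (he : ∀ (φ : PointedHom P P) (f g : L.pointedColorings P), g.1 = φ.hom ∘ f.1 →
      (e g).1 = φ.hom ∘ (e f).1) : ColoringsCorrespond P L L' := by
  refine ⟨(L.pointedHomEquiv P).trans (e.trans (L'.pointedHomEquiv P).symm), fun φ α => ?_⟩
  rw [Equiv.trans_apply, Equiv.trans_apply, Equiv.symm_apply_eq]
  refine Subtype.ext ?_
  rw [he φ (L.pointedHomEquiv P α) _ rfl]
  have h : e (L.pointedHomEquiv P α) = L'.pointedHomEquiv P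
    (((L.pointedHomEquiv P).trans (e.trans (L'.pointedHomEquiv P).symm)) α) := by simp
  rw [h]
  rfl

end LinkoidDiagram

end

/-! ### Isotopies of the sphere preserve orientation -/

noncomputable section

/-- A smooth map to the sphere that is the identity on the sphere near `p`. -/
theorem exists_smooth_retraction (p : S2) :
    ∃ g : E3 → S2, ContMDiff 𝓘(ℝ, E3) (𝓡 2) ∞ g ∧ ∀ᶠ y : S2 in 𝓝 p, g y = y := by
  have := EuclideanSpace.instFactEqNatFinrankFin (𝕜 := ℝ) 3
  let χ : ContDiffBump (p : E3) := ⟨1/4, 1/2, by norm_num, by norm_num⟩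
  -- The cutoff keeps `a x` within `1/2` of the unit vector `p`, hence away from `0`, so normalizing
  -- `a` is smooth on all of `E3`; near `p` the map `a` is the identity.
  let a : E3 → E3 := fun x => (p : E3) + χ x • (x - p)
  have hp : ‖(p : E3)‖ = 1 := norm_eq_of_mem_sphere p
  have ha : ContDiff ℝ ∞ a :=
    contDiff_const.add (χ.contDiff.smul (contDiff_id.sub contDiff_const))
  have hne : ∀ x, a x ≠ 0 := by
    intro x hx
    have h1 : ‖χ x • (x - (p : E3))‖ = 1 := by
      rw [eq_neg_of_add_eq_zero_right hx, norm_neg, hp]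
    have h2 : ‖χ x • (x - (p : E3))‖ ≤ 1/2 := by
      rw [norm_smul, Real.norm_of_nonneg χ.nonneg]
      by_cases hd : dist x p < 1/2
      · rw [dist_eq_norm] at hd
        nlinarith [χ.le_one (x := x), χ.nonneg (x := x), norm_nonneg (x - (p : E3))]
      · rw [χ.zero_of_le_dist (not_lt.1 hd)]
        norm_num
    linarith
  have hb : ContDiff ℝ ∞ fun x => (‖a x‖⁻¹ : ℝ) • a x :=
    ((ha.norm ℝ hne).inv fun x => norm_ne_zero_iff.2 (hne x)).smul ha
  have hs : ∀ x, (‖a x‖⁻¹ : ℝ) • a x ∈ Metric.sphere (0 : E3) 1 := by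
    intro x
    rw [mem_sphere_zero_iff_norm, norm_smul, norm_inv, norm_norm,
      inv_mul_cancel₀ (norm_ne_zero_iff.2 (hne x))]
  refine ⟨fun x => ⟨_, hs x⟩, hb.contMDiff.codRestrict_sphere hs, ?_⟩
  have hc : ∀ᶠ x in 𝓝 (p : E3), a x = x := by
    filter_upwards [Metric.closedBall_mem_nhds (p : E3) (show (0 : ℝ) < 1/4 by norm_num)]
      with x hx
    simp only [a, χ.one_of_mem_closedBall hx, one_smul, add_sub_cancel]
  filter_upwards [continuous_subtype_val.continuousAt.eventually hc] with y hy
  have hy1 : ‖(y : E3)‖ = 1 := norm_eq_of_mem_sphere y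
  ext1
  simp [hy, hy1]

/-- Composing with `g` gives a smooth map between vector spaces, so that ordinary derivatives can
replace those of the manifold. -/
theorem LinkoidDiagram.SphereIsotopy.contDiff_comp (Φ : LinkoidDiagram.SphereIsotopy) {g : E3 → S2}
    (hg : ContMDiff 𝓘(ℝ, E3) (𝓡 2) ∞ g) :
    ContDiff ℝ ∞ fun z : ℝ × E3 => (Φ.diffeo z.1 (g z.2) : E3) := by
  have := EuclideanSpace.instFactEqNatFinrankFin (𝕜 := ℝ) 3
  rw [← contMDiff_iff_contDiff]
  have h1 : ContMDiff 𝓘(ℝ, ℝ × E3) (𝓘(ℝ, ℝ).prod (𝓡 2)) ∞ fun z : ℝ × E3 => (z.1, g z.2) :=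
    (contDiff_fst.contMDiff).prodMk (hg.comp contDiff_snd.contMDiff)
  exact contMDiff_coe_sphere.comp (Φ.smooth.comp h1)

theorem diffeo_contDiff_comp (Ψ : Diffeomorph (𝓡 2) (𝓡 2) S2 S2 ∞) {g : E3 → S2}
    (hg : ContMDiff 𝓘(ℝ, E3) (𝓡 2) ∞ g) : ContDiff ℝ ∞ fun x => (Ψ (g x) : E3) := by
  have := EuclideanSpace.instFactEqNatFinrankFin (𝕜 := ℝ) 3
  rw [← contMDiff_iff_contDiff]
  exact contMDiff_coe_sphere.comp (Ψ.contMDiff.comp hg)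

theorem tripleDet_eq (p v w : E3) : tripleDet p v w =
    p 0 * v 1 * w 2 - p 0 * v 2 * w 1 - p 1 * v 0 * w 2 + p 1 * v 2 * w 0
      + p 2 * v 0 * w 1 - p 2 * v 1 * w 0 := by
  rw [tripleDet, Matrix.det_fin_three]
  rfl

theorem tripleDet_smul (p v w : E3) (a b : ℝ) :
    tripleDet p (a • v) (b • w) = a * b * tripleDet p v w := by
  simp only [tripleDet_eq, PiLp.smul_apply, smul_eq_mul]
  ring

/-- The span of `v` and `w` is orthogonal to `p`; if it contained `p`, then `p` would be orthogonal
to itself. -/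
theorem tripleDet_ne_zero {p v w : E3} (hp : p ≠ 0) (hv : inner ℝ p v = 0) (hw : inner ℝ p w = 0)
    (hvw : LinearIndependent ℝ ![v, w]) : tripleDet p v w ≠ 0 := by
  have hL : LinearIndependent ℝ ![p, v, w] := by
    refine linearIndependent_finCons.2 ⟨hvw, fun h => hp ?_⟩
    have : ∀ x ∈ Submodule.span ℝ (range ![v, w]), inner ℝ p x = 0 := by
      intro x hx
      induction hx using Submodule.span_induction with
      | mem x hx =>
        obtain ⟨i, rfl⟩ := hx
        fin_cases i <;> simp [hv, hw]
      | zero => simp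
      | add x y _ _ hx hy => rw [inner_add_right, hx, hy, add_zero]
      | smul a x _ hx => rw [inner_smul_right, hx, mul_zero]
    exact inner_self_eq_zero.1 (this p h)
  have hL' : LinearIndependent ℝ ![p.ofLp, v.ofLp, w.ofLp] := by
    have := hL.map' (WithLp.linearEquiv 2 ℝ (Fin 3 → ℝ)).toLinearMap (LinearEquiv.ker _)
    have h3 : (WithLp.linearEquiv 2 ℝ (Fin 3 → ℝ)).toLinearMap ∘ ![p, v, w] =
        ![p.ofLp, v.ofLp, w.ofLp] := by
      ext i j
      fin_cases i <;> rfl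
    rwa [h3] at this
  have h := (Matrix.linearIndependent_rows_iff_isUnit (A := Matrix.of ![p.ofLp, v.ofLp, w.ofLp])).1 hL'
  exact ((Matrix.isUnit_iff_isUnit_det _).1 h).ne_zero

/-- Differentiate the constant function `⟪γ s, γ s⟫ = 1`. -/
theorem inner_eq_zero_of_hasDerivAt {γ : ℝ → S2} {v : E3}
    (h : HasDerivAt (fun s => (γ s : E3)) v 0) : inner ℝ (γ 0 : E3) v = 0 := by
  have h1 := h.inner ℝ h
  have h2 : (fun s => inner ℝ (γ s : E3) (γ s : E3)) = fun _ => (1 : ℝ) := by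
    ext s
    have : ‖(γ s : E3)‖ = 1 := norm_eq_of_mem_sphere (γ s)
    rw [real_inner_self_eq_norm_sq, this, one_pow]
  rw [h2] at h1
  have h3 := h1.unique (hasDerivAt_const 0 (1 : ℝ))
  rw [real_inner_comm] at h3
  have h4 := real_inner_comm (γ 0 : E3) v
  linarith

/-- The derivatives at `p` of the stages of an isotopy of the sphere depend continuously on the
time. -/
theorem LinkoidDiagram.SphereIsotopy.exists_velocity (Φ : LinkoidDiagram.SphereIsotopy) (p : S2) :
    ∃ D : ℝ → E3 →ₗ[ℝ] E3, (∀ v, Continuous fun t => D t v) ∧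
      ∀ (γ : ℝ → S2) (v : E3), γ 0 = p → HasDerivAt (fun s => (γ s : E3)) v 0 →
        ∀ t, HasDerivAt (fun s => (Φ.diffeo t (γ s) : E3)) (D t v) 0 := by
  obtain ⟨g, hg, hgp⟩ := exists_smooth_retraction p
  have hF := Φ.contDiff_comp hg
  set F := fun z : ℝ × E3 => (Φ.diffeo z.1 (g z.2) : E3)
  -- `D t` is the partial derivative of `F` at `(t, p)` in the space direction.
  refine ⟨fun t => (fderiv ℝ F (t, (p : E3))).toLinearMap.comp (LinearMap.inr ℝ ℝ E3), ?_, ?_⟩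
  · intro v
    have h1 : Continuous (fderiv ℝ F) := hF.continuous_fderiv (by simp)
    exact (h1.comp (by fun_prop : Continuous fun t : ℝ => (t, (p : E3)))).clm_apply continuous_const
  · rintro γ v rfl hγ t
    have h1 : HasDerivAt (fun s => (t, (γ s : E3))) ((0 : ℝ), v) 0 :=
      (hasDerivAt_const _ _).prodMk hγ
    have h2 : HasFDerivAt F (fderiv ℝ F (t, (γ 0 : E3))) (t, (γ 0 : E3)) :=
      (hF.differentiable (by simp) _).hasFDerivAt
    have h3 := HasFDerivAt.comp_hasDerivAt (x := (0 : ℝ)) (f := fun s => (t, (γ s : E3))) h2 h1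
    refine h3.congr_of_eventuallyEq ?_
    have hc : ContinuousAt γ 0 :=
      Topology.IsInducing.subtypeVal.continuousAt_iff.2 hγ.continuousAt
    filter_upwards [hc.eventually hgp] with s hs
    simp [F, hs]

/-- An isotopy of the sphere preserves the orientation of a pair of tangent vectors. -/
theorem LinkoidDiagram.SphereIsotopy.tripleDet_pos_iff (Φ : LinkoidDiagram.SphereIsotopy) {γ₁ γ₂ : ℝ → S2} {v₁ v₂ : E3}
    (h : γ₁ 0 = γ₂ 0) (h₁ : HasDerivAt (fun s => (γ₁ s : E3)) v₁ 0)
    (h₂ : HasDerivAt (fun s => (γ₂ s : E3)) v₂ 0) (hv : LinearIndependent ℝ ![v₁, v₂]) :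
    0 < tripleDet (Φ.diffeo 1 (γ₂ 0)) (deriv (fun s => (Φ.diffeo 1 (γ₁ s) : E3)) 0)
      (deriv (fun s => (Φ.diffeo 1 (γ₂ s) : E3)) 0) ↔ 0 < tripleDet (γ₂ 0) v₁ v₂ := by
  obtain ⟨D, hDc, hD⟩ := Φ.exists_velocity (γ₂ 0)
  have d₁ := hD γ₁ v₁ h h₁
  have d₂ := hD γ₂ v₂ rfl h₂
  rw [(d₁ 1).deriv, (d₂ 1).deriv]
  have e₁ : D 0 v₁ = v₁ := (d₁ 0).unique (by simpa only [Φ.zero] using h₁)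
  have e₂ : D 0 v₂ = v₂ := (d₂ 0).unique (by simpa only [Φ.zero] using h₂)
  set T : ℝ → ℝ := fun t => tripleDet (Φ.diffeo t (γ₂ 0)) (D t v₁) (D t v₂)
  have hTc : Continuous T := by
    have hp : Continuous fun t => (Φ.diffeo t (γ₂ 0) : E3) :=
      continuous_subtype_val.comp (Φ.smooth.continuous.comp (by fun_prop : Continuous fun t : ℝ => (t, γ₂ 0)))
    have c₁ := hDc v₁
    have c₂ := hDc v₂
    simp only [T, tripleDet_eq]
    fun_prop
  have hT0 : ∀ t, T t ≠ 0 := by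
    intro t
    have hn : ‖(Φ.diffeo t (γ₂ 0) : E3)‖ = 1 := norm_eq_of_mem_sphere _
    refine tripleDet_ne_zero (fun h0 => by simp [h0] at hn) ?_ ?_ ?_
    · rw [← h]
      exact inner_eq_zero_of_hasDerivAt (γ := fun s => Φ.diffeo t (γ₁ s)) (d₁ t)
    · exact inner_eq_zero_of_hasDerivAt (γ := fun s => Φ.diffeo t (γ₂ s)) (d₂ t)
    -- The derivative `A` of the inverse of the stage `t` sends `D t v₁` and `D t v₂` back to the
    -- independent vectors `v₁` and `v₂`.
    · obtain ⟨g, hg, hgp⟩ := exists_smooth_retraction (Φ.diffeo t (γ₂ 0))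
      have hH := diffeo_contDiff_comp (Φ.diffeo t).symm hg
      set H := fun x => ((Φ.diffeo t).symm (g x) : E3)
      set A := fderiv ℝ H (Φ.diffeo t (γ₂ 0))
      have key : ∀ (γ : ℝ → S2) (v : E3), γ 0 = γ₂ 0 → HasDerivAt (fun s => (γ s : E3)) v 0 →
          A (D t v) = v := by
        intro γ v h0 hγ
        have a1 := hD γ v h0 hγ t
        have a2 : HasFDerivAt H A (Φ.diffeo t (γ 0)) := by
          rw [h0]
          exact (hH.differentiable (by simp) _).hasFDerivAt
        have a3 := HasFDerivAt.comp_hasDerivAt (x := (0 : ℝ))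
          (f := fun s => (Φ.diffeo t (γ s) : E3)) a2 a1
        refine a3.unique (hγ.congr_of_eventuallyEq ?_)
        have hc : ContinuousAt (fun s => Φ.diffeo t (γ s)) 0 :=
          Topology.IsInducing.subtypeVal.continuousAt_iff.2 a1.continuousAt
        rw [← h0] at hgp
        filter_upwards [hc.eventually hgp] with s hs
        simp [H, hs]
      refine LinearIndependent.of_comp A.toLinearMap ?_
      convert hv using 1
      ext i : 1
      fin_cases i
      · exact key γ₁ v₁ h h₁
      · exact key γ₂ v₂ rfl h₂
  have hpre : IsPreconnected (T '' univ) := isPreconnected_univ.image _ hTc.continuousOn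
  have hT00 : T 0 = tripleDet (γ₂ 0) v₁ v₂ := by simp only [T, e₁, e₂, Φ.zero]
  rw [← hT00]
  change 0 < T 1 ↔ 0 < T 0
  -- Intermediate values: a change of sign would force a zero of `T`.
  have hno : ∀ a b, 0 < T a → 0 < T b := by
    intro a b ha
    by_contra hb
    obtain ⟨c, -, hc⟩ := hpre.ordConnected.out (mem_image_of_mem T (mem_univ b))
      (mem_image_of_mem T (mem_univ a)) ⟨not_lt.1 hb, ha.le⟩
    exact hT0 c hc
  exact ⟨hno 1 0, hno 0 1⟩

end
-- Invariance under isotopy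
namespace LinkoidDiagram

variable {n m : ℕ} {X : Type v} [Quandle X] {L L' : LinkoidDiagram n m}

theorem map_nhdsWithin_of_deriv_pos {h : ℝ → ℝ} (hs : ContDiff ℝ ∞ h) (h0 : h 0 = 0)
    (hd : ∀ s, 0 < deriv h s) :
    map h (𝓝[<] 0) = 𝓝[<] 0 ∧ map h (𝓝[>] 0) = 𝓝[>] 0 := by
  have hm : StrictMono h := strictMono_of_deriv_pos hd
  have hn : map h (𝓝 0) = 𝓝 0 := by
    have := (hs.contDiffAt.hasStrictDerivAt (x := 0) (by simp)).map_nhds_eq (hd 0).ne'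
    rwa [h0] at this
  have hl : h ⁻¹' Iio 0 = Iio 0 := by
    ext s
    rw [mem_preimage, mem_Iio, mem_Iio, ← hm.lt_iff_lt (a := s), h0]
  have hr : h ⁻¹' Ioi 0 = Ioi 0 := by
    ext s
    rw [mem_preimage, mem_Ioi, mem_Ioi, ← hm.lt_iff_lt (b := s), h0]
  constructor
  · rw [nhdsWithin, ← hl, map_inf_principal_preimage, hn, hl]
  · rw [nhdsWithin, ← hr, map_inf_principal_preimage, hn, hr]

theorem isCrossing_iff_of_isotopic {Ψ : S2 → S2} (hΨ : Function.Injective Ψ)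
    {φ : Src n m ≃ₜ Src n m} (hL : ∀ x, L'.toFun x = Ψ (L.toFun (φ x)))
    (hu : ∀ x, x ∈ L'.under ↔ φ x ∈ L.under) (p q : Src n m) :
    L'.IsCrossing p q ↔ L.IsCrossing (φ p) (φ q) := by
  rw [IsCrossing, IsCrossing, hL, hL, hΨ.eq_iff, hu, φ.injective.ne_iff]

/-- Reparametrization multiplies the two velocities by positive numbers, which does not affect the
sign of the triple product, and the isotopy preserves that sign. -/
theorem isPositive_iff_of_isotopic (Φ : SphereIsotopy) {φ : Src n m ≃ₜ Src n m} (hφ : IsReparam φ)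
    (hL : ∀ x, L'.toFun x = Φ.diffeo 1 (L.toFun (φ x))) {p q : Src n m}
    (hpq : L.IsCrossing (φ p) (φ q)) (hpq' : L'.IsCrossing p q) :
    L'.IsPositive p q ↔ L.IsPositive (φ p) (φ q) := by
  have key : ∀ x, ¬ x.IsEnd → ¬ (φ x).IsEnd → ∃ c : ℝ, 0 < c ∧
      HasDerivAt (fun s => (L.toFun (φ (x.flow s)) : E3)) (c • velocity L.toFun (φ x)) 0 := by
    intro x hx hx'
    obtain ⟨h, hs, h0, hd, he⟩ := hφ.2.2 x
    refine ⟨deriv h 0, hd 0, ?_⟩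
    have h1 : HasDerivAt h (deriv h 0) 0 := (hs.differentiable (by simp) 0).hasDerivAt
    have h2 := hasDerivAt_flow (L := L) hx'
    rw [← h0] at h2
    have h3 := HasDerivAt.scomp (x := (0 : ℝ)) (h := h) h2 h1
    refine h3.congr_of_eventuallyEq ?_
    filter_upwards [Src.reach_mem_nhds hx] with s hs
    simp [he s hs]
  have hvel : ∀ x, ¬ x.IsEnd → velocity L'.toFun x =
      deriv (fun s => (Φ.diffeo 1 (L.toFun (φ (x.flow s))) : E3)) 0 := by
    intro x hx
    rw [velocity, derivWithin_of_mem_nhds (Src.reach_mem_nhds hx)]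
    simp only [hL]
  have hp := L'.not_end p q hpq'.1 hpq'.2.1
  have hq := L'.not_isEnd_of_under hpq'.2.2
  obtain ⟨a, ha, hda⟩ := key p hp (L.not_end _ _ hpq.1 hpq.2.1)
  obtain ⟨b, hb, hdb⟩ := key q hq (L.not_isEnd_of_under hpq.2.2)
  have hli : LinearIndependent ℝ ![a • velocity L.toFun (φ p), b • velocity L.toFun (φ q)] := by
    have h := (L.transverse _ _ hpq.1 hpq.2.1).units_smul ![Units.mk0 a ha.ne', Units.mk0 b hb.ne']
    convert h using 1
    ext i : 1
    fin_cases i <;> rfl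
  have h := Φ.tripleDet_pos_iff (γ₁ := fun s => L.toFun (φ (p.flow s)))
    (γ₂ := fun s => L.toFun (φ (q.flow s))) (by simpa only [Src.flow_zero] using hpq.2.1) hda hdb hli
  rw [tripleDet_smul, mul_pos_iff_of_pos_left (mul_pos ha hb)] at h
  simp only [Src.flow_zero] at h
  rw [IsPositive, IsPositive, hvel p hp, hvel q hq, hL]
  exact h

/-- The coloring conditions for `f ∘ φ` at `x` are those for `f` at `φ x`: `φ` is a homeomorphism,
its time change preserves one-sided neighborhoods of `0`, and crossings and signs correspond. -/
theorem isColoring_comp_iff_of_isotopic (Φ : SphereIsotopy) {φ : Src n m ≃ₜ Src n m}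
    (hφ : IsReparam φ) (hL : ∀ x, L'.toFun x = Φ.diffeo 1 (L.toFun (φ x)))
    (hu : ∀ x, x ∈ L'.under ↔ φ x ∈ L.under) (f : Src n m → X) :
    L'.IsColoring (f ∘ φ) ↔ L.IsColoring f := by
  have key : ∀ x, L'.IsColoringAt (f ∘ φ) x ↔ L.IsColoringAt f (φ x) := by
    intro x
    have hn : (∀ᶠ y in 𝓝 x, f (φ y) = f (φ x)) ↔ ∀ᶠ y in 𝓝 (φ x), f y = f (φ x) := by
      rw [← φ.map_nhds_eq, eventually_map]
    obtain ⟨h, hs, h0, hd, he⟩ := hφ.2.2 x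
    obtain ⟨hl, hr⟩ := map_nhdsWithin_of_deriv_pos hs h0 hd
    have hl' : x ∈ L'.under → ∀ z, (∀ᶠ s in 𝓝[<] (0 : ℝ), f (φ (x.flow s)) = z) ↔
        ∀ᶠ s in 𝓝[<] (0 : ℝ), f ((φ x).flow s) = z := by
      intro hx z
      nth_rewrite 2 [← hl]
      rw [eventually_map]
      refine eventually_congr ?_
      filter_upwards [nhdsWithin_le_nhds (Src.reach_mem_nhds (L'.not_isEnd_of_under hx))] with s hs
      rw [he s hs]
    have hr' : x ∈ L'.under → ∀ z, (∀ᶠ s in 𝓝[>] (0 : ℝ), f (φ (x.flow s)) = z) ↔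
        ∀ᶠ s in 𝓝[>] (0 : ℝ), f ((φ x).flow s) = z := by
      intro hx z
      nth_rewrite 2 [← hr]
      rw [eventually_map]
      refine eventually_congr ?_
      filter_upwards [nhdsWithin_le_nhds (Src.reach_mem_nhds (L'.not_isEnd_of_under hx))] with s hs
      rw [he s hs]
    have hc := fun p => isCrossing_iff_of_isotopic (Φ.diffeo 1).injective hL hu p x
    have hca : ∀ p, L.IsCrossing (φ p) (φ x) → ∀ y z : X,
        L'.crossAct p x y z = L.crossAct (φ p) (φ x) y z := by
      intro p hp y z
      exact crossAct_congr (isPositive_iff_of_isotopic Φ hφ hL hp ((hc p).2 hp)) y z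
    constructor
    · rintro ⟨h1, h2, h3⟩
      refine ⟨fun hx => hn.1 (h1 (mt (hu x).1 hx)),
        fun hx => (hl' ((hu x).2 hx) _).1 (h2 ((hu x).2 hx)), fun p hp => ?_⟩
      obtain ⟨p, rfl⟩ := φ.surjective p
      rw [← hca p hp, ← hr' ((hu x).2 hp.2.2)]
      exact h3 p ((hc p).2 hp)
    · rintro ⟨h1, h2, h3⟩
      refine ⟨fun hx => hn.2 (h1 (mt (hu x).2 hx)),
        fun hx => (hl' hx _).2 (h2 ((hu x).1 hx)), fun p hp => ?_⟩
      have hp' := (hc p).1 hp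
      have h4 := h3 _ hp'
      rw [← hca p hp', ← hr' hp.2.2] at h4
      exact h4
  constructor
  · intro h x
    obtain ⟨x, rfl⟩ := φ.surjective x
    exact (key x).1 (h x)
  · exact fun h x => (key x).2 (h _)

theorem Isotopic.colorings_correspond (h : Isotopic L L') (P : PointedQuandle.{u} (2 * n)) :
    ColoringsCorrespond P L L' := by
  obtain ⟨Φ, φ, hφ, hL, hu⟩ := h
  have hb : ∀ j : Fin (2 * n), φ (basepoint j) = basepoint j := by
    intro j
    unfold basepoint
    split_ifs
    · exact hφ.1 _
    · exact hφ.2.1 _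
  refine colorings_correspond_of_equiv
    (Equiv.subtypeEquiv (Equiv.arrowCongr φ.symm.toEquiv (Equiv.refl _)) fun f => ?_) ?_
  · change f ∈ L.pointedColorings P ↔ f ∘ φ ∈ L'.pointedColorings P
    refine and_congr (isColoring_comp_iff_of_isotopic Φ hφ hL hu f).symm (forall_congr' fun j => ?_)
    rw [Function.comp_apply, hb]
  · rintro φ' ⟨f, hf⟩ ⟨g, hg⟩ (rfl : g = _)
    rfl

end LinkoidDiagram

/-! ### One-sided neighborhoods -/

theorem map_add_left_nhdsLT_zero (s : ℝ) : map (s + ·) (𝓝[<] 0) = 𝓝[<] s := by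
  have h : (s + ·) ⁻¹' Iio s = Iio 0 := by ext t; simp
  have h' := (Homeomorph.addLeft s).map_nhds_eq 0
  simp only [Homeomorph.coe_addLeft, add_zero] at h'
  rw [nhdsWithin, ← h, map_inf_principal_preimage, h']
  rfl

theorem map_add_left_nhdsGT_zero (s : ℝ) : map (s + ·) (𝓝[>] 0) = 𝓝[>] s := by
  have h : (s + ·) ⁻¹' Ioi s = Ioi 0 := by ext t; simp
  have h' := (Homeomorph.addLeft s).map_nhds_eq 0
  simp only [Homeomorph.coe_addLeft, add_zero] at h'
  rw [nhdsWithin, ← h, map_inf_principal_preimage, h']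
  rfl

/-- At an endpoint of the interval the outer side contains no point of `Icc a b`, so nothing is
required there. -/
theorem eventually_of_one_sided {a b s : ℝ} {p : ℝ → Prop} (h : p s)
    (hl : a < s → ∀ᶠ t in 𝓝[<] s, p t) (hr : s < b → ∀ᶠ t in 𝓝[>] s, p t) (hs : s ∈ Icc a b) :
    ∀ᶠ t in 𝓝 s, t ∈ Icc a b → p t := by
  have h1 : ∀ᶠ t in 𝓝[<] s, t ∈ Icc a b → p t := by
    rcases eq_or_lt_of_le hs.1 with h | h
    · filter_upwards [self_mem_nhdsWithin] with t ht ht'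
      exact absurd (ht'.1.trans_lt ht) (by simpa using h.ge)
    · exact (hl h).mono fun t ht _ => ht
  have h2 : ∀ᶠ t in 𝓝[>] s, t ∈ Icc a b → p t := by
    rcases eq_or_lt_of_le hs.2 with h | h
    · filter_upwards [self_mem_nhdsWithin] with t ht ht'
      exact absurd (lt_of_lt_of_le ht ht'.2) (by simpa using h.ge)
    · exact (hr h).mono fun t ht _ => ht
  have h3 := eventually_sup.2 ⟨h1, h2⟩
  rw [nhdsLT_sup_nhdsGT, eventually_nhdsWithin_iff] at h3
  filter_upwards [h3] with t ht ht'
  by_cases hts : t = s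
  · rwa [hts]
  · exact ht hts ht'

theorem Src.mem_reach_of_not_isEnd {n m : ℕ} {x : Src n m} {s : ℝ} (h : ¬ (x.flow s).IsEnd) :
    s ∈ x.reach := by
  rcases x with ⟨i, t⟩ | ⟨j, θ⟩
  · by_contra hs
    simp only [reach, mem_ofPred_eq, mem_Icc, not_and_or, not_le] at hs
    refine h ⟨i, ?_⟩
    rcases hs with hs | hs
    · exact Or.inl (by simp only [flow, projIcc_of_le_left zero_le_one hs.le]; rfl)
    · exact Or.inr (by simp only [flow, projIcc_of_right_le zero_le_one hs.le]; rfl)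
  · trivial

/-! ### Local changes and the gluing of colorings -/

namespace LinkoidDiagram

variable {n m : ℕ} {X : Type v} [Quandle X] {L L' : LinkoidDiagram n m}

theorem isOpen_disc (Ψ : Diffeomorph (𝓡 2) (𝓡 2) S2 S2 ∞) : IsOpen (disc Ψ) := by
  have h : IsOpen {p : S2 | 0 < (p : E3) 2} :=
    isOpen_lt continuous_const (by fun_prop)
  exact Ψ.toHomeomorph.isOpenMap _ h

namespace LocalChange

variable {k : ℕ}

/-- A local change, read backwards. -/
def symm (W : LocalChange L L' k) : LocalChange L' L k where
  chart := W.chart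
  start := W.start
  len := W.len
  len_pos := W.len_pos
  injective := W.injective
  not_end := W.not_end
  preimage := W.preimage'
  preimage' := W.preimage
  boundary x y hx hxy := by
    have key : ∀ z, L'.toFun z ∉ disc W.chart → L.toFun z ∉ disc W.chart := fun z hz h =>
      hz ((W.preimage' z).2 ((W.preimage z).1 h))
    have hd : L'.toFun x ∉ disc W.chart := (isOpen_disc W.chart).frontier_eq ▸ hx |>.2
    have ex := W.agree x (key x hd)
    have ey := W.agree y (key y (hxy ▸ hd))
    exact W.boundary x y (ex ▸ hx) (by rw [← ex, ← ey, hxy])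
  agree x hx := (W.agree x fun h => hx ((W.preimage' x).2 ((W.preimage x).1 h))).symm
  agree_under x hx := (W.agree_under x fun h => hx ((W.preimage' x).2 ((W.preimage x).1 h))).symm

variable (W : LocalChange L L' k)

/-- The positions on the strands, including the ends of the strands. -/
def positions : Set (Fin k × ℝ) := {c | c.2 ∈ Icc 0 (W.len c.1)}

theorem continuous_point : Continuous W.point :=
  continuous_prod_of_discrete_left.2 fun r => (W.start r).continuous_flow

theorem injOn_point : InjOn W.point W.positions := by
  rintro ⟨r, s⟩ hc ⟨r', s'⟩ hc' h
  obtain ⟨h1, h2⟩ := W.injective r r' s s' hc hc' h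
  rw [h1, h2]

theorem isCompact_positions : IsCompact W.positions := by
  have h : W.positions = ⋃ r, {r} ×ˢ Icc 0 (W.len r) := by
    ext ⟨r, s⟩
    simp [positions]
  rw [h]
  exact isCompact_iUnion fun r => isCompact_singleton.prod isCompact_Icc

theorem point_flow {r : Fin k} {s : ℝ} (hs : s ∈ Icc 0 (W.len r)) (t : ℝ) :
    (W.point (r, s)).flow t = W.point (r, s + t) :=
  Src.flow_flow (Src.mem_reach_of_not_isEnd (W.not_end r s hs)) t

/-- The positions of the points near `x` are near the position of `x`. -/
theorem eventually_position_mem {x : Src n m} {N : Set (Fin k × ℝ)} (hN : IsOpen N)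
    (h : ∀ c ∈ W.positions, W.point c = x → c ∈ N) :
    ∀ᶠ y in 𝓝 x, ∀ c ∈ W.positions, W.point c = y → c ∈ N := by
  have hc : IsClosed (W.point '' (W.positions \ N)) :=
    ((W.isCompact_positions.diff hN).image W.continuous_point).isClosed
  have hx : x ∉ W.point '' (W.positions \ N) := by
    rintro ⟨c, hc, rfl⟩
    exact hc.2 (h c hc.1 rfl)
  filter_upwards [hc.isOpen_compl.mem_nhds hx] with y hy c hc hcy
  by_contra hcN
  exact hy ⟨c, ⟨hc, hcN⟩, hcy⟩

theorem mem_disc_iff {x : Src n m} :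
    L.toFun x ∈ disc W.chart ↔ ∃ c : Fin k × ℝ, c.2 ∈ Ioo 0 (W.len c.1) ∧ W.point c = x := by
  rw [W.preimage]
  constructor
  · rintro ⟨r, s, hs, rfl⟩
    exact ⟨(r, s), hs, rfl⟩
  · rintro ⟨⟨r, s⟩, hs, rfl⟩
    exact ⟨r, s, hs, rfl⟩

theorem point_mem_disc {c : Fin k × ℝ} (hc : c.2 ∈ Ioo 0 (W.len c.1)) :
    L.toFun (W.point c) ∈ disc W.chart := W.mem_disc_iff.2 ⟨c, hc, rfl⟩

theorem mem_Ioo_of_mem_disc {c : Fin k × ℝ} (hc : c ∈ W.positions)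
    (h : L.toFun (W.point c) ∈ disc W.chart) : c.2 ∈ Ioo 0 (W.len c.1) := by
  obtain ⟨c', hc', he⟩ := W.mem_disc_iff.1 h
  rwa [← W.injOn_point (Ioo_subset_Icc_self hc') hc he]

theorem mem_disc_iff' {x : Src n m} : L'.toFun x ∈ disc W.chart ↔ L.toFun x ∈ disc W.chart := by
  rw [W.preimage, W.preimage']

/-- An end of a strand. -/
def IsStrandEnd (c : Fin k × ℝ) : Prop := c.2 = 0 ∨ c.2 = W.len c.1

variable {W}

theorem IsStrandEnd.mem_positions {c : Fin k × ℝ} (hc : W.IsStrandEnd c) : c ∈ W.positions := by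
  have h := (W.len_pos c.1).le
  rcases hc with hc | hc <;> simp [positions, hc, h]

theorem IsStrandEnd.notMem_disc {c : Fin k × ℝ} (hc : W.IsStrandEnd c) :
    L.toFun (W.point c) ∉ disc W.chart := by
  intro h
  have h' := W.mem_Ioo_of_mem_disc hc.mem_positions h
  rcases hc with hc | hc
  · exact h'.1.ne' hc
  · exact h'.2.ne hc

/-- The end is a limit of points of the strand inside the disc but is not itself mapped into the
open disc. Its image is therefore on the frontier, over which the diagram is injective. Thus strand
ends take part in no crossing. -/
theorem IsStrandEnd.eq_of_toFun_eq {c : Fin k × ℝ} (hc : W.IsStrandEnd c) {y : Src n m}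
    (h : L.toFun (W.point c) = L.toFun y) : W.point c = y := by
  refine W.boundary _ _ ?_ h
  rw [(isOpen_disc W.chart).frontier_eq]
  refine ⟨?_, hc.notMem_disc⟩
  have hcont : Continuous fun s => L.toFun (W.point (c.1, s)) :=
    L.continuous_toFun.comp (W.start c.1).continuous_flow
  have hcl : c.2 ∈ closure (Ioo 0 (W.len c.1)) := by
    rw [closure_Ioo (W.len_pos c.1).ne]
    exact hc.mem_positions
  exact map_mem_closure (f := fun s : ℝ => L.toFun (W.point (c.1, s))) hcont hcl fun s hs => W.point_mem_disc (c := (c.1, s)) hs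

theorem IsStrandEnd.notMem_under {c : Fin k × ℝ} (hc : W.IsStrandEnd c) :
    W.point c ∉ L.under := by
  intro h
  obtain ⟨y, hne, he⟩ := L.double_of_under _ h
  exact hne (hc.eq_of_toFun_eq he)

theorem isStrandEnd_or_mem_Ioo {c : Fin k × ℝ} (hc : c ∈ W.positions) :
    W.IsStrandEnd c ∨ c.2 ∈ Ioo 0 (W.len c.1) := by
  rcases eq_or_lt_of_le hc.1 with h | h
  · exact Or.inl (Or.inl h.symm)
  · rcases eq_or_lt_of_le hc.2 with h' | h'
    · exact Or.inl (Or.inr h')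
    · exact Or.inr ⟨h, h'⟩

/-- An undercrossing on a closed strand is not at a strand end, so its image is in the disc; the
upper point has the same image and hence lies on an open strand as well. -/
theorem exists_mem_crossings {c : Fin k × ℝ} (hc : c ∈ W.positions) {p : Src n m}
    (hp : L.IsCrossing p (W.point c)) : ∃ d, W.point d = p ∧ (d, c) ∈ W.crossings L := by
  have hI := (isStrandEnd_or_mem_Ioo hc).resolve_left fun h => h.notMem_under hp.2.2
  have h1 : L.toFun p ∈ disc W.chart := hp.2.1 ▸ W.point_mem_disc hI
  obtain ⟨d, hd, rfl⟩ := W.mem_disc_iff.1 h1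
  exact ⟨d, rfl, hd, hI, hp⟩

variable (W)

/-- The conditions on the strand `r` for a function on the strands to be the restriction of a
coloring of `K`. -/
structure IsStrandColoringAt (K : LinkoidDiagram n m) (c : Fin k × ℝ → X) (r : Fin k) : Prop where
  left : ∀ s ∈ Ioc 0 (W.len r), ∀ᶠ t in 𝓝[<] s, c (r, t) = c (r, s)
  right : ∀ s ∈ Ico 0 (W.len r), (∀ p, (p, (r, s)) ∉ W.crossings K) →
    ∀ᶠ t in 𝓝[>] s, c (r, t) = c (r, s)
  jump : ∀ p s, (p, (r, s)) ∈ W.crossings K →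
    ∀ᶠ t in 𝓝[>] s, c (r, t) = K.crossAct (W.point p) (W.point (r, s)) (c p) (c (r, s))

/-- The restrictions of the colorings of `K` to the strands. -/
def IsStrandColoring (K : LinkoidDiagram n m) (c : Fin k × ℝ → X) : Prop :=
  ∀ r, W.IsStrandColoringAt K c r

theorem isStrandColoring_comp_point {f : Src n m → X} (hf : L.IsColoring f) :
    W.IsStrandColoring L fun c => f (W.point c) := by
  have hcont : ∀ r s, Tendsto (fun t => W.point (r, t)) (𝓝 s) (𝓝 (W.point (r, s))) :=
    fun r s => (W.start r).continuous_flow.tendsto s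
  refine fun r => ⟨fun s hs => ?_, fun s hs hp => ?_, fun p s hc => ?_⟩
  · by_cases hx : W.point (r, s) ∈ L.under
    · rw [← map_add_left_nhdsLT_zero, eventually_map]
      simpa only [W.point_flow (Ioc_subset_Icc_self hs)] using (hf _).left hx
    · exact nhdsWithin_le_nhds ((hcont r s).eventually ((hf _).const hx))
  · have hx : W.point (r, s) ∉ L.under := by
      intro hx
      obtain ⟨p, hp'⟩ := exists_isCrossing hx
      obtain ⟨d, -, hd⟩ := exists_mem_crossings (c := (r, s)) (Ico_subset_Icc_self hs) hp'
      exact hp d hd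
    exact nhdsWithin_le_nhds ((hcont r s).eventually ((hf _).const hx))
  · obtain ⟨hp, hq, h⟩ := hc
    rw [← map_add_left_nhdsGT_zero, eventually_map]
    simpa only [W.point_flow (Ioo_subset_Icc_self hq)] using (hf _).right _ h

theorem isCrossing_iff_of_notMem {p q : Src n m} (hp : L.toFun p ∉ disc W.chart)
    (hq : L.toFun q ∉ disc W.chart) : L'.IsCrossing p q ↔ L.IsCrossing p q := by
  rw [IsCrossing, IsCrossing, W.agree p hp, W.agree q hq, W.agree_under q hq]

/-- Near a point that is not on a closed strand the diagrams agree. -/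
theorem eventually_notMem_disc {x : Src n m} (hx : ∀ c ∈ W.positions, W.point c ≠ x) :
    ∀ᶠ y in 𝓝 x, L.toFun y ∉ disc W.chart := by
  filter_upwards [W.eventually_position_mem isOpen_empty fun c hc h => (hx c hc h).elim] with y hy h
  obtain ⟨c, hc, he⟩ := W.mem_disc_iff.1 h
  exact hy c (Ioo_subset_Icc_self hc) he

theorem velocity_eq {x : Src n m} (hx : ∀ c ∈ W.positions, W.point c ≠ x) :
    velocity L'.toFun x = velocity L.toFun x := by
  refine Filter.EventuallyEq.derivWithin_eq ?_ ?_
  · filter_upwards [nhdsWithin_le_nhds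
      ((Src.tendsto_flow_zero x).eventually (W.eventually_notMem_disc hx))] with s hs
    rw [W.agree _ hs]
  · rw [Src.flow_zero, W.agree _ (W.eventually_notMem_disc hx).self_of_nhds]

open Classical in
/-- The function with the values of `c` on the open strands and those of `f` elsewhere. -/
noncomputable def glue (f : Src n m → X) (c : Fin k × ℝ → X) (x : Src n m) : X :=
  if h : ∃ d : Fin k × ℝ, d.2 ∈ Ioo 0 (W.len d.1) ∧ W.point d = x then c h.choose else f x

theorem glue_of_notMem {Y : Type*} {f : Src n m → Y} {c : Fin k × ℝ → Y} {x : Src n m}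
    (hx : L.toFun x ∉ disc W.chart) : W.glue f c x = f x :=
  dif_neg fun h => hx (W.mem_disc_iff.2 h)

theorem glue_of_mem {Y : Type*} {f : Src n m → Y} {c : Fin k × ℝ → Y} {d : Fin k × ℝ}
    (hd : d.2 ∈ Ioo 0 (W.len d.1)) : W.glue f c (W.point d) = c d := by
  have h : ∃ e : Fin k × ℝ, e.2 ∈ Ioo 0 (W.len e.1) ∧ W.point e = W.point d := ⟨d, hd, rfl⟩
  rw [glue, dif_pos h]
  congr 1
  exact W.injOn_point (Ioo_subset_Icc_self h.choose_spec.1) (Ioo_subset_Icc_self hd)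
    h.choose_spec.2

theorem glue_of_mem_positions {Y : Type*} {f : Src n m → Y} {c : Fin k × ℝ → Y}
    (hcf : ∀ d, W.IsStrandEnd d → c d = f (W.point d)) {d : Fin k × ℝ} (hd : d ∈ W.positions) :
    W.glue f c (W.point d) = c d := by
  rcases isStrandEnd_or_mem_Ioo hd with h | h
  · rw [W.glue_of_notMem h.notMem_disc, hcf d h]
  · exact W.glue_of_mem h

/-- A coloring of `L` and a coloring of the strands of `L'` with the same values at the ends of the
strands combine to a coloring of `L'`. -/
theorem isColoring_glue {f : Src n m → X} (hf : L.IsColoring f) {c : Fin k × ℝ → X}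
    (hc : W.IsStrandColoring L' c) (hcf : ∀ d, W.IsStrandEnd d → c d = f (W.point d)) :
    L'.IsColoring (W.glue f c) := by
  intro x
  -- Off the closed strands nothing changes: near such a point the diagrams agree and the glued
  -- function is `f`.
  by_cases hx : ∀ d ∈ W.positions, W.point d ≠ x
  · have hev := W.eventually_notMem_disc hx
    have hxd := hev.self_of_nhds
    refine ⟨fun hu => ?_, fun hu => ?_, fun p hp => ?_⟩
    · filter_upwards [hev, (hf x).const (mt (W.agree_under x hxd).2 hu)] with y hy hy'
      rw [W.glue_of_notMem hy, W.glue_of_notMem hxd, hy']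
    · filter_upwards [nhdsWithin_le_nhds ((Src.tendsto_flow_zero x).eventually hev),
        (hf x).left ((W.agree_under x hxd).1 hu)] with s hs hs'
      rw [W.glue_of_notMem hs, W.glue_of_notMem hxd, hs']
    · have hxd' : L'.toFun x ∉ disc W.chart := mt W.mem_disc_iff'.1 hxd
      have hpd : L.toFun p ∉ disc W.chart := mt W.mem_disc_iff'.2 (hp.2.1 ▸ hxd')
      have hp' := (W.isCrossing_iff_of_notMem hpd hxd).1 hp
      -- Equality of the signs requires the diagrams to agree in a neighborhood of `p`, not only at
      -- `p`; so `p` must not be a strand end either.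
      have hpp : ∀ d ∈ W.positions, W.point d ≠ p := by
        rintro d hd rfl
        rcases isStrandEnd_or_mem_Ioo hd with h | h
        · exact hp'.1 (h.eq_of_toFun_eq hp'.2.1)
        · exact hpd (W.point_mem_disc h)
      have hs : L'.crossAct p x (f p) (f x) = L.crossAct p x (f p) (f x) := by
        refine crossAct_congr ?_ _ _
        rw [IsPositive, IsPositive, W.velocity_eq hx, W.velocity_eq hpp, W.agree x hxd]
      filter_upwards [nhdsWithin_le_nhds ((Src.tendsto_flow_zero x).eventually hev),
        (hf x).right p hp'] with s h1 h2
      rw [W.glue_of_notMem h1, W.glue_of_notMem hxd, W.glue_of_notMem hpd, h2, hs]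
  · push Not at hx
    obtain ⟨⟨r, s⟩, hd, rfl⟩ := hx
    have hg : ∀ d ∈ W.positions, W.glue f c (W.point d) = c d :=
      fun d hd => W.glue_of_mem_positions hcf hd
    refine ⟨fun hu => ?_, fun hu => ?_, fun p hp => ?_⟩
    · have hno : ∀ p, (p, (r, s)) ∉ W.crossings L' := fun p hp => hu hp.2.2.2.2
      have hl : ∀ᶠ t in 𝓝 s, t ∈ Icc 0 (W.len r) → c (r, t) = c (r, s) := by
        exact eventually_of_one_sided rfl (fun h => (hc r).left s ⟨h, hd.2⟩)
          (fun h => (hc r).right s ⟨hd.1, h⟩ hno) hd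
      obtain ⟨U, hU, hUo, hsU⟩ := eventually_nhds_iff.1 hl
      -- By compactness of the closed strands, points near this one that lie on a strand lie on the
      -- same strand, at nearby times.
      have hpos := W.eventually_position_mem (x := W.point (r, s)) (N := {r} ×ˢ U)
        ((isOpen_discrete _).prod hUo) fun d hd' he => by
          rw [W.injOn_point hd' hd he]
          exact ⟨rfl, hsU⟩
      -- Nearby points outside the disc exist only at a strand end, where `f` is locally constant
      -- since the end is not an undercrossing.
      have hfar : ∀ᶠ y in 𝓝 (W.point (r, s)), L.toFun y ∉ disc W.chart →
          f y = c (r, s) := by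
        rcases isStrandEnd_or_mem_Ioo hd with h | h
        · filter_upwards [(hf _).const h.notMem_under] with y hy _
          rw [hy, hcf _ h]
        · filter_upwards [((isOpen_disc W.chart).preimage L.continuous_toFun).mem_nhds
            (W.point_mem_disc h)] with y hy hy'
          exact absurd hy hy'
      filter_upwards [hpos, hfar] with y h1 h2
      rw [hg _ hd]
      by_cases hy : L.toFun y ∈ disc W.chart
      · obtain ⟨⟨r', t⟩, hd', rfl⟩ := W.mem_disc_iff.1 hy
        have hd'' := Ioo_subset_Icc_self hd'
        obtain ⟨rfl : r' = r, ht⟩ := h1 _ hd'' rfl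
        rw [hg (r', t) hd'']
        exact hU t ht hd''
      · rw [W.glue_of_notMem hy, h2 hy]
    · have hI := (isStrandEnd_or_mem_Ioo hd).resolve_left
        fun h => IsStrandEnd.notMem_under (W := W.symm) h hu
      have h1 := (hc r).left s ⟨hI.1, hI.2.le⟩
      rw [← map_add_left_nhdsLT_zero, eventually_map] at h1
      have h2 : ∀ᶠ t in 𝓝[<] (0 : ℝ), s + t ∈ Ioo 0 (W.len r) := nhdsWithin_le_nhds <|
        (by fun_prop : Continuous fun t : ℝ => s + t).continuousAt.eventually_mem
          (Ioo_mem_nhds (by simpa using hI.1) (by simpa using hI.2))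
      filter_upwards [h1, h2] with t h1 h2
      rw [hg _ hd, W.point_flow hd, hg (r, s + t) (Ioo_subset_Icc_self h2), h1]
    · obtain ⟨d, rfl, hdc⟩ := exists_mem_crossings (W := W.symm) hd hp
      have hI : s ∈ Ioo 0 (W.len r) := hdc.2.1
      have h1 := (hc r).jump _ _ hdc
      rw [← map_add_left_nhdsGT_zero, eventually_map] at h1
      have h2 : ∀ᶠ t in 𝓝[>] (0 : ℝ), s + t ∈ Ioo 0 (W.len r) := nhdsWithin_le_nhds <|
        (by fun_prop : Continuous fun t : ℝ => s + t).continuousAt.eventually_mem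
          (Ioo_mem_nhds (by simpa using hI.1) (by simpa using hI.2))
      filter_upwards [h1, h2] with t h1 h2
      rw [hg _ hd, W.point_flow hd, hg (r, s + t) (Ioo_subset_Icc_self h2), h1]
      exact congrArg (fun z => L'.crossAct (W.point d) (W.point (r, s)) z (c (r, s)))
        (hg d (Ioo_subset_Icc_self hdc.1)).symm

end LocalChange

end LinkoidDiagram

/-! ### Step functions of a real variable -/

section StepFunctions

variable {X : Type v}

/-- For the discrete topology on `X` the function is continuous on a connected interval. -/
theorem eq_of_one_sided {d : ℝ → X} {a b : ℝ} (hl : ∀ s ∈ Ioc a b, ∀ᶠ t in 𝓝[<] s, d t = d s)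
    (hr : ∀ s ∈ Ico a b, ∀ᶠ t in 𝓝[>] s, d t = d s) {t : ℝ} (ht : t ∈ Icc a b) : d t = d a := by
  let _ : TopologicalSpace X := ⊥
  have _ : DiscreteTopology X := ⟨rfl⟩
  have hc : ContinuousOn d (Icc a b) := by
    intro s hs
    rw [ContinuousWithinAt, nhds_discrete, tendsto_pure, eventually_nhdsWithin_iff]
    exact eventually_of_one_sided rfl (fun h => hl s ⟨h, hs.2⟩) (fun h => hr s ⟨hs.1, h⟩) hs
  exact isPreconnected_Icc.constant hc ht (left_mem_Icc.2 (ht.1.trans ht.2))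

theorem eq_of_jump {d : ℝ → X} {a b : ℝ} {y : X}
    (hl : ∀ s ∈ Ioc a b, ∀ᶠ t in 𝓝[<] s, d t = d s)
    (hr : ∀ s ∈ Ioo a b, ∀ᶠ t in 𝓝[>] s, d t = d s) (hj : ∀ᶠ t in 𝓝[>] a, d t = y) {t : ℝ}
    (ht : t ∈ Ioc a b) : d t = y := by
  obtain ⟨t₀, h, h'⟩ := (hj.and (Ioo_mem_nhdsGT ht.1)).exists
  rw [← h]
  exact eq_of_one_sided (b := t) (fun s hs => hl s ⟨h'.1.trans hs.1, hs.2.trans ht.2⟩)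
    (fun s hs => hr s ⟨h'.1.trans_le hs.1, hs.2.trans_le ht.2⟩) ⟨h'.2.le, le_rfl⟩

/-- The function that is `x` up to `u`, and `g` after `u`. -/
noncomputable def switch (u : ℝ) (x : X) (g : ℝ → X) (s : ℝ) : X := if s ≤ u then x else g s

theorem switch_of_le {u s : ℝ} (x : X) (g : ℝ → X) (h : s ≤ u) : switch u x g s = x := if_pos h

theorem switch_of_lt {u s : ℝ} (x : X) (g : ℝ → X) (h : u < s) : switch u x g s = g s :=
  if_neg h.not_ge

/-- The value at the switching time is still the earlier one, in accordance with the arriving color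
at an undercrossing. -/
theorem switch_left {u s : ℝ} {x : X} {g : ℝ → X} (hg : ∀ᶠ t in 𝓝[<] s, g t = g s) :
    ∀ᶠ t in 𝓝[<] s, switch u x g t = switch u x g s := by
  rcases le_or_gt s u with h | h
  · filter_upwards [self_mem_nhdsWithin] with t ht
    rw [switch_of_le x g h, switch_of_le x g ((mem_Iio.1 ht).le.trans h)]
  · filter_upwards [hg, Ioo_mem_nhdsLT h] with t ht ht'
    rw [switch_of_lt x g h, switch_of_lt x g ht'.1, ht]

theorem switch_jump {u s : ℝ} {x y : X} {g : ℝ → X} (h : u ≤ s) (hg : ∀ᶠ t in 𝓝[>] s, g t = y) :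
    ∀ᶠ t in 𝓝[>] s, switch u x g t = y := by
  filter_upwards [hg, self_mem_nhdsWithin] with t ht ht'
  rw [switch_of_lt x g (h.trans_lt ht'), ht]

theorem switch_right {u s : ℝ} {x : X} {g : ℝ → X} (hs : s ≠ u)
    (hg : ∀ᶠ t in 𝓝[>] s, g t = g s) : ∀ᶠ t in 𝓝[>] s, switch u x g t = switch u x g s := by
  rcases lt_or_gt_of_ne hs with h | h
  · filter_upwards [Ioo_mem_nhdsGT h] with t ht
    rw [switch_of_le x g h.le, switch_of_le x g ht.2.le]
  · rw [switch_of_lt x g h]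
    exact switch_jump h.le hg

end StepFunctions

/-! ### Transport of colorings across a disc -/

namespace LinkoidDiagram

variable {n m : ℕ} {X : Type v} [Quandle X] {L L' : LinkoidDiagram n m}

theorem crossAct_self (L : LinkoidDiagram n m) (p q : Src n m) (x : X) : L.crossAct p q x x = x := by
  unfold crossAct
  split_ifs
  · exact Quandle.fix
  · exact Quandle.fix_inv

theorem crossAct_injective (L : LinkoidDiagram n m) (p q : Src n m) (x : X) :
    Function.Injective (L.crossAct p q x) := by
  intro y z h
  unfold crossAct at h
  split_ifs at h
  · exact Rack.left_cancel x |>.1 h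
  · exact Rack.left_cancel_inv x |>.1 h

namespace LocalChange

variable {k : ℕ} (W : LocalChange L L' k)

/-- Every choice of colors at the starts of the strands extends uniquely to a coloring of the
strands of `K`, and `sol` gives this extension. -/
structure IsSolution (K : LinkoidDiagram n m) (sol : (Fin k → X) → Fin k × ℝ → X) : Prop where
  eq_start : ∀ α r, sol α (r, 0) = α r
  isStrandColoring : ∀ α, W.IsStrandColoring K (sol α)
  unique : ∀ c, W.IsStrandColoring K c → ∀ r, ∀ s ∈ Icc 0 (W.len r),
    c (r, s) = sol (fun r => c (r, 0)) (r, s)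

variable {W}

theorem IsStrandColoringAt.symm {K : LinkoidDiagram n m} {c : Fin k × ℝ → X} {r : Fin k}
    (h : W.IsStrandColoringAt K c r) : W.symm.IsStrandColoringAt K c r :=
  ⟨h.left, h.right, h.jump⟩

theorem IsSolution.symm {K : LinkoidDiagram n m} {sol : (Fin k → X) → Fin k × ℝ → X}
    (h : W.IsSolution K sol) : W.symm.IsSolution K sol where
  eq_start := h.eq_start
  isStrandColoring α r := (h.isStrandColoring α r).symm
  unique c hc := h.unique c fun r => (hc r).symm

variable {sol sol' : (Fin k → X) → Fin k × ℝ → X}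

/-- Keep `f` outside the disc and extend its start colors by `sol'` inside. The two fit at the far
ends because `f` itself follows `sol` on the strands. -/
theorem IsSolution.exists_coloring (h : W.IsSolution L sol) (h' : W.IsSolution L' sol')
    (he : ∀ α r, sol α (r, W.len r) = sol' α (r, W.len r)) {f : Src n m → X}
    (hf : L.IsColoring f) :
    ∃ g, L'.IsColoring g ∧ ∀ x, L.toFun x ∉ disc W.chart → g x = f x := by
  set α : Fin k → X := fun r => f (W.point (r, 0))
  refine ⟨W.glue f (sol' α), W.isColoring_glue hf (h'.isStrandColoring α) ?_,
    fun x hx => W.glue_of_notMem hx⟩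
  rintro ⟨r, s⟩ ((rfl : s = 0) | (rfl : s = W.len r))
  · exact h'.eq_start α r
  · rw [← he α r]
    exact (h.unique _ (W.isStrandColoring_comp_point hf) r _
      (right_mem_Icc.2 (W.len_pos r).le)).symm

/-- The starts of the strands are outside the disc, and the colors there determine those inside. -/
theorem IsSolution.coloring_ext (h : W.IsSolution L sol) {f g : Src n m → X}
    (hf : L.IsColoring f) (hg : L.IsColoring g)
    (hfg : ∀ x, L.toFun x ∉ disc W.chart → f x = g x) : f = g := by
  ext x
  by_cases hx : L.toFun x ∈ disc W.chart
  · obtain ⟨⟨r, s⟩, hs, rfl⟩ := W.mem_disc_iff.1 hx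
    have h1 := h.unique _ (W.isStrandColoring_comp_point hf) r s (Ioo_subset_Icc_self hs)
    have h2 := h.unique _ (W.isStrandColoring_comp_point hg) r s (Ioo_subset_Icc_self hs)
    have h3 : (fun r => f (W.point (r, 0))) = fun r => g (W.point (r, 0)) :=
      funext fun r => hfg _ (IsStrandEnd.notMem_disc (W := W) (c := (r, 0)) (Or.inl rfl))
    rw [h1, h2, h3]
  · exact hfg x hx

theorem basepoint_notMem_disc (W : LocalChange L L' k) (j : Fin (2 * n)) :
    L.toFun (basepoint j) ∉ disc W.chart := by
  intro h
  obtain ⟨⟨r, s⟩, hs, he⟩ := W.mem_disc_iff.1 h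
  exact W.not_end r s (Ioo_subset_Icc_self hs) (show (W.point (r, s)).IsEnd by
    rw [he]; exact isEnd_basepoint j)

theorem IsSolution.colorings_correspond {P : PointedQuandle.{u} (2 * n)}
    {sol sol' : (Fin k → P.carrier) → Fin k × ℝ → P.carrier} (h : W.IsSolution L sol)
    (h' : W.IsSolution L' sol') (he : ∀ α r, sol α (r, W.len r) = sol' α (r, W.len r)) :
    ColoringsCorrespond P L L' := by
  have ex : ∀ f : L.pointedColorings P, ∃ g : L'.pointedColorings P,
      ∀ x, L.toFun x ∉ disc W.chart → g.1 x = f.1 x := by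
    rintro ⟨f, hf, hb⟩
    obtain ⟨g, hg, hgf⟩ := h.exists_coloring h' he hf
    exact ⟨⟨g, hg, fun j => (hgf _ (W.basepoint_notMem_disc j)).trans (hb j)⟩, hgf⟩
  have ex' : ∀ g : L'.pointedColorings P, ∃ f : L.pointedColorings P,
      ∀ x, L.toFun x ∉ disc W.chart → f.1 x = g.1 x := by
    rintro ⟨g, hg, hb⟩
    obtain ⟨f, hf, hgf⟩ := h'.symm.exists_coloring h.symm (fun α r => (he α r).symm) hg
    exact ⟨⟨f, hf, fun j => (hgf _ (W.symm.basepoint_notMem_disc j)).trans (hb j)⟩,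
      fun x hx => hgf x (mt W.mem_disc_iff'.1 hx)⟩
  have uq : ∀ f f' : Src n m → P.carrier, L.IsColoring f → L.IsColoring f' →
      (∀ x, L.toFun x ∉ disc W.chart → f x = f' x) → f = f' := fun f f' => h.coloring_ext
  have uq' : ∀ f f' : Src n m → P.carrier, L'.IsColoring f → L'.IsColoring f' →
      (∀ x, L.toFun x ∉ disc W.chart → f x = f' x) → f = f' := fun f f' hf hf' hff =>
    h'.symm.coloring_ext hf hf' fun x hx => hff x (mt W.mem_disc_iff'.2 hx)
  choose F hF using ex
  choose G hG using ex'
  refine colorings_correspond_of_equiv ⟨F, G, fun f => Subtype.ext ?_, fun g => Subtype.ext ?_⟩ ?_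
  · exact uq _ _ (G (F f)).2.1 f.2.1 fun x hx => by rw [hG _ x hx, hF _ x hx]
  · exact uq' _ _ (F (G g)).2.1 g.2.1 fun x hx => by rw [hF _ x hx, hG _ x hx]
  · intro φ f g hgf
    -- The image under `φ` of the coloring `F f` is again a coloring of `L'`; it agrees with `F g`
    -- off the disc, hence everywhere.
    refine uq' _ _ (F g).2.1 ((F f).2.1.map φ.hom) fun x hx => ?_
    change (F g).1 x = φ.hom ((F f).1 x)
    rw [hF _ x hx, hF _ x hx, hgf]
    rfl

section Strands

variable {K : LinkoidDiagram n m} {c : Fin k × ℝ → X} {r : Fin k}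

theorem isStrandColoringAt_of_const (h : ∀ p s, (p, (r, s)) ∉ W.crossings K) {x : X}
    (hc : ∀ t, c (r, t) = x) : W.IsStrandColoringAt K c r where
  left s _ := by simp [hc]
  right s _ _ := by simp [hc]
  jump p s hp := (h p s hp).elim

theorem IsStrandColoringAt.eq_const (hc : W.IsStrandColoringAt K c r) {b : ℝ} (hb : b ≤ W.len r)
    (h : ∀ p, ∀ s < b, (p, (r, s)) ∉ W.crossings K) {t : ℝ} (ht : t ∈ Icc 0 b) :
    c (r, t) = c (r, 0) :=
  eq_of_one_sided (d := fun t => c (r, t)) (fun s hs => hc.left s ⟨hs.1, hs.2.trans hb⟩)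
    (fun s hs => hc.right s ⟨hs.1, hs.2.trans_le hb⟩ fun p => h p s hs.2) ht

theorem IsStrandColoringAt.eq_crossAct (hc : W.IsStrandColoringAt K c r) {p : Fin k × ℝ} {u b : ℝ}
    (hp : (p, (r, u)) ∈ W.crossings K) (hb : b ≤ W.len r)
    (h : ∀ p, ∀ s ∈ Ioo u b, (p, (r, s)) ∉ W.crossings K) {t : ℝ} (ht : t ∈ Ioc u b) :
    c (r, t) = K.crossAct (W.point p) (W.point (r, u)) (c p) (c (r, u)) := by
  have hu : 0 < u := hp.2.1.1
  exact eq_of_jump (d := fun t => c (r, t)) (fun s hs => hc.left s ⟨hu.trans hs.1, hs.2.trans hb⟩)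
    (fun s hs => hc.right s ⟨(hu.trans hs.1).le, hs.2.trans_le hb⟩ fun p => h p s hs)
    (hc.jump p u hp) ht

variable {p₁ p₂ : Fin k × ℝ} {u v : ℝ}

/-- The color at the upper point is read from `c` itself, so `p₁` may lie on the same strand `r`, as
it does for a kink. -/
theorem isStrandColoringAt_of_one
    (h : ∀ p s, (p, (r, s)) ∈ W.crossings K → p = p₁ ∧ s = u)
    (h₁ : (p₁, (r, u)) ∈ W.crossings K) {x : X}
    (hc : ∀ t, c (r, t) =
      switch u x (fun _ => K.crossAct (W.point p₁) (W.point (r, u)) (c p₁) x) t) :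
    W.IsStrandColoringAt K c r where
  left s _ := by
    simp only [hc]
    exact switch_left (Eventually.of_forall fun _ => rfl)
  right s _ hs := by
    simp only [hc]
    exact switch_right (by rintro rfl; exact hs _ h₁) (Eventually.of_forall fun _ => rfl)
  jump p s hp := by
    obtain ⟨rfl, rfl⟩ := h p s hp
    rw [hc s, switch_of_le _ _ le_rfl]
    simp only [hc]
    exact switch_jump le_rfl (Eventually.of_forall fun _ => rfl)

theorem IsStrandColoringAt.eq_one (hc : W.IsStrandColoringAt K c r)
    (h : ∀ p s, (p, (r, s)) ∈ W.crossings K → p = p₁ ∧ s = u)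
    (h₁ : (p₁, (r, u)) ∈ W.crossings K) {t : ℝ} (ht : t ∈ Icc 0 (W.len r)) :
    c (r, t) = switch u (c (r, 0))
      (fun _ => K.crossAct (W.point p₁) (W.point (r, u)) (c p₁) (c (r, 0))) t := by
  have hu : u ∈ Ioo 0 (W.len r) := h₁.2.1
  have h0 : ∀ t ∈ Icc 0 u, c (r, t) = c (r, 0) := fun t ht => hc.eq_const hu.2.le
    (fun p s hs hp => hs.ne (h p s hp).2) ht
  rcases le_or_gt t u with htu | htu
  · rw [switch_of_le _ _ htu, h0 t ⟨ht.1, htu⟩]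
  · rw [switch_of_lt _ _ htu, hc.eq_crossAct h₁ le_rfl
      (fun p s hs hp => hs.1.ne' (h p s hp).2) ⟨htu, ht.2⟩, h0 u ⟨hu.1.le, le_rfl⟩]

theorem isStrandColoringAt_of_two (huv : u < v)
    (h : ∀ p s, (p, (r, s)) ∈ W.crossings K → (p = p₁ ∧ s = u) ∨ (p = p₂ ∧ s = v))
    (h₁ : (p₁, (r, u)) ∈ W.crossings K) (h₂ : (p₂, (r, v)) ∈ W.crossings K) {x y : X}
    (hy : y = K.crossAct (W.point p₁) (W.point (r, u)) (c p₁) x)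
    (hc : ∀ t, c (r, t) = switch u x
      (switch v y (fun _ => K.crossAct (W.point p₂) (W.point (r, v)) (c p₂) y)) t) :
    W.IsStrandColoringAt K c r where
  left s _ := by
    simp only [hc]
    exact switch_left (switch_left (Eventually.of_forall fun _ => rfl))
  right s _ hs := by
    simp only [hc]
    exact switch_right (by rintro rfl; exact hs _ h₁)
      (switch_right (by rintro rfl; exact hs _ h₂) (Eventually.of_forall fun _ => rfl))
  jump p s hp := by
    rcases h p s hp with ⟨rfl, rfl⟩ | ⟨rfl, rfl⟩
    · rw [hc s, switch_of_le _ _ le_rfl, ← hy]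
      simp only [hc]
      refine switch_jump le_rfl ?_
      filter_upwards [Ioo_mem_nhdsGT huv] with t ht
      rw [switch_of_le _ _ ht.2.le]
    · rw [hc s, switch_of_lt _ _ huv, switch_of_le _ _ le_rfl]
      simp only [hc]
      exact switch_jump huv.le (switch_jump le_rfl (Eventually.of_forall fun _ => rfl))

theorem IsStrandColoringAt.eq_two (hc : W.IsStrandColoringAt K c r) (huv : u < v)
    (h : ∀ p s, (p, (r, s)) ∈ W.crossings K → (p = p₁ ∧ s = u) ∨ (p = p₂ ∧ s = v))
    (h₁ : (p₁, (r, u)) ∈ W.crossings K) (h₂ : (p₂, (r, v)) ∈ W.crossings K) {y : X}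
    (hy : y = K.crossAct (W.point p₁) (W.point (r, u)) (c p₁) (c (r, 0))) {t : ℝ}
    (ht : t ∈ Icc 0 (W.len r)) :
    c (r, t) = switch u (c (r, 0))
      (switch v y (fun _ => K.crossAct (W.point p₂) (W.point (r, v)) (c p₂) y)) t := by
  have hu : u ∈ Ioo 0 (W.len r) := h₁.2.1
  have hv : v ∈ Ioo 0 (W.len r) := h₂.2.1
  have h0 : ∀ t ∈ Icc 0 u, c (r, t) = c (r, 0) := fun t ht => hc.eq_const hu.2.le
    (fun p s hs hp => by rcases h p s hp with h | h <;> linarith [h.2]) ht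
  have h1 : ∀ t ∈ Ioc u v, c (r, t) = y := by
    intro t ht
    rw [hc.eq_crossAct h₁ hv.2.le
      (fun p s hs hp => by rcases h p s hp with h | h <;> linarith [h.2, hs.1, hs.2]) ht, hy,
      h0 u ⟨hu.1.le, le_rfl⟩]
  rcases le_or_gt t u with htu | htu
  · rw [switch_of_le _ _ htu, h0 t ⟨ht.1, htu⟩]
  · rw [switch_of_lt _ _ htu]
    rcases le_or_gt t v with htv | htv
    · rw [switch_of_le _ _ htv, h1 t ⟨htu, htv⟩]
    · rw [switch_of_lt _ _ htv, hc.eq_crossAct h₂ le_rfl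
        (fun p s hs hp => by rcases h p s hp with h | h <;> linarith [h.2, hs.1, hs.2])
        ⟨htv, ht.2⟩, h1 v ⟨huv, le_rfl⟩]

end Strands

end LocalChange

end LinkoidDiagram

/-! ### The first and the second Reidemeister move -/

namespace LinkoidDiagram

variable {n m : ℕ} {X : Type v} [Quandle X] {L L' : LinkoidDiagram n m}

namespace LocalChange

variable {k : ℕ} {W : LocalChange L L' k} {K : LinkoidDiagram n m}

theorem isSolution_of_crossings_eq_empty (h : W.crossings K = ∅) :
    W.IsSolution K fun (α : Fin k → X) d => α d.1 where
  eq_start _ _ := rfl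
  isStrandColoring α r := isStrandColoringAt_of_const (by simp [h]) fun _ => rfl
  unique c hc r s hs := (hc r).eq_const le_rfl (by simp [h]) hs

/-- By idempotence the constant function is a coloring. Conversely, if `x` is the color of the upper
point and `y` the initial color, then either `x = y`, or the upper point comes after the crossing
and `x` is the result of `x` acting on `y`; as `x` fixes itself and acts injectively, again `x = y`.
-/
theorem isSolution_kink {W : LocalChange L L' 1} {p q : Fin 1 × ℝ}
    (h : W.crossings K = {(p, q)}) : W.IsSolution K fun (α : Fin 1 → X) d => α d.1 := by
  obtain ⟨r, a⟩ := p
  obtain ⟨r', b⟩ := q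
  obtain rfl := Subsingleton.elim 0 r
  obtain rfl := Subsingleton.elim 0 r'
  have hm : (((0 : Fin 1), a), ((0 : Fin 1), b)) ∈ W.crossings K := by rw [h]; rfl
  have hu : ∀ (p : Fin 1 × ℝ) (s : ℝ), (p, ((0 : Fin 1), s)) ∈ W.crossings K →
      p = (0, a) ∧ s = b := by
    intro p s hp
    simpa [h] using hp
  refine ⟨fun _ _ => rfl, fun α r => ?_, fun c hc r s hs => ?_⟩
  · obtain rfl := Subsingleton.elim 0 r
    refine isStrandColoringAt_of_one hu hm (x := α 0) fun t => ?_
    rw [crossAct_self]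
    unfold switch
    split_ifs <;> rfl
  · obtain rfl := Subsingleton.elim 0 r
    have key := fun s hs => (hc 0).eq_one hu hm (t := s) hs
    have h0 : c (0, a) = c (0, 0) := by
      have ha := key a (Ioo_subset_Icc_self hm.1)
      rcases le_or_gt a b with hab | hab
      · rwa [switch_of_le _ _ hab] at ha
      · rw [switch_of_lt _ _ hab] at ha
        nth_rewrite 1 [← crossAct_self K (W.point (0, a)) (W.point (0, b)) (c (0, a))] at ha
        exact crossAct_injective _ _ _ _ ha
    rw [key s hs, h0, crossAct_self]
    unfold switch
    split_ifs <;> rfl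

theorem crossAct_crossAct_of_not_iff {p q p' q' : Src n m}
    (h : K.IsPositive p q ↔ ¬ K.IsPositive p' q') (x y : X) :
    K.crossAct p' q' x (K.crossAct p q x y) = y := by
  unfold crossAct
  by_cases h' : K.IsPositive p' q'
  · rw [if_pos h', if_neg (fun h1 => h.1 h1 h')]
    exact Rack.right_inv x y
  · rw [if_neg h', if_pos (h.2 h')]
    exact Rack.left_inv x y

/-- The colors of two strands, the first of which passes twice over the second. -/
noncomputable def bigonColor (W : LocalChange L L' 2) (K : LinkoidDiagram n m) (a₁ b₁ b₂ : ℝ)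
    (α : Fin 2 → X) (d : Fin 2 × ℝ) : X :=
  if d.1 = 0 then α 0 else
    switch b₁ (α 1) (switch b₂
      (K.crossAct (W.point (0, a₁)) (W.point (1, b₁)) (α 0) (α 1)) fun _ => α 1) d.2

/-- The upper strand has one color, which acts on the lower strand once with each sign; the two
actions cancel. -/
theorem isSolution_bigon {W : LocalChange L L' 2} {a₁ a₂ b₁ b₂ : ℝ}
    (h : W.crossings K = {((0, a₁), (1, b₁)), ((0, a₂), (1, b₂))})
    (hs : W.Pos K (0, a₁) (1, b₁) ↔ ¬ W.Pos K (0, a₂) (1, b₂)) (hb : b₁ < b₂) :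
    W.IsSolution K (bigonColor (X := X) W K a₁ b₁ b₂) := by
  have h1 : (((0 : Fin 2), a₁), ((1 : Fin 2), b₁)) ∈ W.crossings K := by rw [h]; exact Or.inl rfl
  have h2 : (((0 : Fin 2), a₂), ((1 : Fin 2), b₂)) ∈ W.crossings K := by rw [h]; exact Or.inr rfl
  have hu0 : ∀ (p : Fin 2 × ℝ) (s : ℝ), (p, ((0 : Fin 2), s)) ∉ W.crossings K := by simp [h]
  have hu1 : ∀ (p : Fin 2 × ℝ) (s : ℝ), (p, ((1 : Fin 2), s)) ∈ W.crossings K →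
      (p = (0, a₁) ∧ s = b₁) ∨ (p = (0, a₂) ∧ s = b₂) := by
    intro p s hp
    simpa [h] using hp
  refine ⟨fun α r => ?_, fun α => Fin.forall_fin_two.2 ⟨?_, ?_⟩, fun c hc =>
    Fin.forall_fin_two.2 ⟨fun s ht => ?_, fun s ht => ?_⟩⟩
  · revert r
    refine Fin.forall_fin_two.2 ⟨rfl, ?_⟩
    exact switch_of_le _ _ h1.2.1.1.le
  · exact isStrandColoringAt_of_const hu0 fun t => rfl
  · refine isStrandColoringAt_of_two hb hu1 h1 h2 (x := α 1) rfl fun t => ?_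
    change switch b₁ (α 1) _ t = _
    congr 2
    funext _
    exact (crossAct_crossAct_of_not_iff hs (α 0) (α 1)).symm
  · exact (hc 0).eq_const le_rfl (fun p s _ => hu0 p s) ht
  · have e : ∀ t ∈ Icc 0 (W.len 0), c (0, t) = c (0, 0) := fun t ht =>
      (hc 0).eq_const le_rfl (fun p s _ => hu0 p s) ht
    rw [(hc 1).eq_two hb hu1 h1 h2 rfl ht, e a₁ (Ioo_subset_Icc_self h1.1),
      e a₂ (Ioo_subset_Icc_self h2.1), crossAct_crossAct_of_not_iff hs]
    rfl

end LocalChange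

open LocalChange

theorem ReidemeisterI.colorings_correspond (h : ReidemeisterI L L')
    (P : PointedQuandle.{u} (2 * n)) : ColoringsCorrespond P L L' := by
  obtain ⟨W, p, q, h1, h2⟩ := h
  exact (isSolution_kink h1).colorings_correspond (isSolution_of_crossings_eq_empty h2)
    fun _ _ => rfl

theorem ReidemeisterII.colorings_correspond (h : ReidemeisterII L L')
    (P : PointedQuandle.{u} (2 * n)) : ColoringsCorrespond P L L' := by
  obtain ⟨W, a₁, a₂, b₁, b₂, h1, hs, h2⟩ := h
  have key : ∀ {a₁ a₂ b₁ b₂ : ℝ}, W.crossings L = {((0, a₁), (1, b₁)), ((0, a₂), (1, b₂))} →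
      (W.Pos L (0, a₁) (1, b₁) ↔ ¬ W.Pos L (0, a₂) (1, b₂)) → b₁ < b₂ →
      ColoringsCorrespond P L L' := by
    intro a₁ a₂ b₁ b₂ h1 hs hb
    have hm1 : (((0 : Fin 2), a₁), ((1 : Fin 2), b₁)) ∈ W.crossings L := by
      rw [h1]; exact Or.inl rfl
    have hm2 : (((0 : Fin 2), a₂), ((1 : Fin 2), b₂)) ∈ W.crossings L := by
      rw [h1]; exact Or.inr rfl
    refine (isSolution_bigon h1 hs hb).colorings_correspond (isSolution_of_crossings_eq_empty h2)
      fun α => Fin.forall_fin_two.2 ⟨rfl, ?_⟩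
    change switch b₁ _ _ (W.len 1) = _
    rw [switch_of_lt _ _ hm1.2.1.2, switch_of_lt _ _ hm2.2.1.2]
  rcases lt_trichotomy b₁ b₂ with hb | rfl | hb
  · exact key h1 hs hb
  -- With equal lower points the two upper points coincide too, so a single crossing would have two
  -- opposite signs.
  · have hm1 : (((0 : Fin 2), a₁), ((1 : Fin 2), b₁)) ∈ W.crossings L := by
      rw [h1]; exact Or.inl rfl
    have hm2 : (((0 : Fin 2), a₂), ((1 : Fin 2), b₁)) ∈ W.crossings L := by
      rw [h1]; exact Or.inr rfl
    have he := hm1.2.2.over_unique hm2.2.2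
    simp only [LocalChange.Pos, he] at hs
    exact absurd hs (by tauto)
  · exact key (by rw [h1, Set.pair_comm]) (by tauto) hb

end LinkoidDiagram

/-! ### The third Reidemeister move -/

namespace LinkoidDiagram

variable {n m : ℕ} {X : Type v} [Quandle X] {L L' : LinkoidDiagram n m}

namespace LocalChange

/-- The color of the middle strand of a triangle. -/
noncomputable def middleColor (W : LocalChange L L' 3) (K : LinkoidDiagram n m) (a₁ b₁ : ℝ)
    (x y : X) : ℝ → X :=
  switch b₁ y fun _ => K.crossAct (W.point (0, a₁)) (W.point (1, b₁)) x y

/-- The color of the bottom strand of a triangle. -/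
noncomputable def bottomColor (W : LocalChange L L' 3) (K : LinkoidDiagram n m)
    (a₂ b₃ c₂ c₃ : ℝ) (x w z : X) : ℝ → X :=
  if c₂ < c₃ then
    switch c₂ z (switch c₃ (K.crossAct (W.point (0, a₂)) (W.point (2, c₂)) x z) fun _ =>
      K.crossAct (W.point (1, b₃)) (W.point (2, c₃)) w
        (K.crossAct (W.point (0, a₂)) (W.point (2, c₂)) x z))
  else
    switch c₃ z (switch c₂ (K.crossAct (W.point (1, b₃)) (W.point (2, c₃)) w z) fun _ =>
      K.crossAct (W.point (0, a₂)) (W.point (2, c₂)) x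
        (K.crossAct (W.point (1, b₃)) (W.point (2, c₃)) w z))

/-- The colors of the three strands of a triangle. -/
noncomputable def triangleColor (W : LocalChange L L' 3) (K : LinkoidDiagram n m)
    (a₁ a₂ b₁ b₃ c₂ c₃ : ℝ) (α : Fin 3 → X) (d : Fin 3 × ℝ) : X :=
  ![fun _ => α 0, middleColor W K a₁ b₁ (α 0) (α 1),
    bottomColor W K a₂ b₃ c₂ c₃ (α 0) (middleColor W K a₁ b₁ (α 0) (α 1) b₃) (α 2)] d.1 d.2

theorem forall_fin_three {p : Fin 3 → Prop} (h0 : p 0) (h1 : p 1) (h2 : p 2) (r : Fin 3) : p r := by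
  fin_cases r
  exacts [h0, h1, h2]

variable {W : LocalChange L L' 3} {K : LinkoidDiagram n m} {a₁ a₂ b₁ b₃ c₂ c₃ : ℝ}

/-- The crossings of a triangle with the strands `0`, `1`, `2` from top to bottom. -/
structure IsTriangle (W : LocalChange L L' 3) (K : LinkoidDiagram n m)
    (a₁ a₂ b₁ b₃ c₂ c₃ : ℝ) : Prop where
  mem₁ : ((0, a₁), (1, b₁)) ∈ W.crossings K
  mem₂ : ((0, a₂), (2, c₂)) ∈ W.crossings K
  mem₃ : ((1, b₃), (2, c₃)) ∈ W.crossings K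
  top : ∀ p s, (p, ((0 : Fin 3), s)) ∉ W.crossings K
  middle : ∀ p s, (p, ((1 : Fin 3), s)) ∈ W.crossings K → p = (0, a₁) ∧ s = b₁
  bottom : ∀ p s, (p, ((2 : Fin 3), s)) ∈ W.crossings K →
    (p = (0, a₂) ∧ s = c₂) ∨ (p = (1, b₃) ∧ s = c₃)

theorem isTriangle_of_crossings_eq
    (h : W.crossings K = {((0, a₁), (1, b₁)), ((0, a₂), (2, c₂)), ((1, b₃), (2, c₃))}) :
    IsTriangle W K a₁ a₂ b₁ b₃ c₂ c₃ where
  mem₁ := by simp [h]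
  mem₂ := by simp [h]
  mem₃ := by simp [h]
  top := by simp [h]
  middle := by simp [h]
  bottom := by simp [h]

namespace IsTriangle

/-- Otherwise one point would be both the lower and the upper preimage of a crossing. -/
theorem middle_ne (h : IsTriangle W K a₁ a₂ b₁ b₃ c₂ c₃) : b₁ ≠ b₃ := by
  rintro rfl
  exact IsCrossing.over_notMem h.mem₃.2.2 h.mem₁.2.2.2.2

/-- Otherwise one lower point would lie under two different strands. -/
theorem bottom_ne (h : IsTriangle W K a₁ a₂ b₁ b₃ c₂ c₃) : c₂ ≠ c₃ := by
  rintro rfl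
  have he := IsCrossing.over_unique h.mem₂.2.2 h.mem₃.2.2
  have h1 := W.injOn_point (Ioo_subset_Icc_self h.mem₂.1) (Ioo_subset_Icc_self h.mem₃.1) he
  simp at h1

/-- Colors are determined from top to bottom: the top strand is constant, it fixes the jump of the
middle strand, and both fix the two jumps of the bottom strand, in whichever order these occur. -/
theorem isSolution (h : IsTriangle W K a₁ a₂ b₁ b₃ c₂ c₃) :
    W.IsSolution K (triangleColor (X := X) W K a₁ a₂ b₁ b₃ c₂ c₃) := by
  refine ⟨fun α => forall_fin_three rfl ?_ ?_, fun α => forall_fin_three ?_ ?_ ?_,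
    fun c hc => ?_⟩
  · change middleColor W K a₁ b₁ (α 0) (α 1) 0 = α 1
    exact switch_of_le _ _ h.mem₁.2.1.1.le
  · change bottomColor W K a₂ b₃ c₂ c₃ _ _ _ 0 = _
    unfold bottomColor
    split_ifs
    · exact switch_of_le _ _ h.mem₂.2.1.1.le
    · exact switch_of_le _ _ h.mem₃.2.1.1.le
  · exact isStrandColoringAt_of_const h.top fun t => rfl
  · exact isStrandColoringAt_of_one h.middle h.mem₁ (x := α 1) fun t => rfl
  · rcases lt_or_gt_of_ne h.bottom_ne with hlt | hlt
    · refine isStrandColoringAt_of_two hlt h.bottom h.mem₂ h.mem₃ (x := α 2) rfl fun t => ?_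
      change bottomColor W K a₂ b₃ c₂ c₃ _ _ _ t = _
      rw [bottomColor, if_pos hlt]
      rfl
    · refine isStrandColoringAt_of_two hlt (fun p s hp => (h.bottom p s hp).symm) h.mem₃ h.mem₂
        (x := α 2) rfl fun t => ?_
      change bottomColor W K a₂ b₃ c₂ c₃ _ _ _ t = _
      rw [bottomColor, if_neg hlt.not_gt]
      rfl
  · have e0 : ∀ t ∈ Icc 0 (W.len 0), c (0, t) = c (0, 0) := fun t ht =>
      (hc 0).eq_const le_rfl (fun p s _ => h.top p s) ht
    have e1 : ∀ t ∈ Icc 0 (W.len 1), c (1, t) =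
        middleColor W K a₁ b₁ (c (0, 0)) (c (1, 0)) t := by
      intro t ht
      rw [(hc 1).eq_one h.middle h.mem₁ ht, e0 a₁ (Ioo_subset_Icc_self h.mem₁.1)]
      rfl
    have ea := e0 a₂ (Ioo_subset_Icc_self h.mem₂.1)
    have eb := e1 b₃ (Ioo_subset_Icc_self h.mem₃.1)
    refine forall_fin_three e0 e1 fun t ht => ?_
    change _ = bottomColor W K a₂ b₃ c₂ c₃ _ _ _ t
    rcases lt_or_gt_of_ne h.bottom_ne with hlt | hlt
    · rw [(hc 2).eq_two hlt h.bottom h.mem₂ h.mem₃ rfl ht, ea, eb, bottomColor, if_pos hlt]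
    · rw [(hc 2).eq_two hlt (fun p s hp => (h.bottom p s hp).symm) h.mem₃ h.mem₂ rfl ht, ea, eb,
        bottomColor, if_neg hlt.not_gt]

theorem middleColor_end (h : IsTriangle W K a₁ a₂ b₁ b₃ c₂ c₃) (x y : X) :
    middleColor W K a₁ b₁ x y (W.len 1) =
    K.crossAct (W.point (0, a₁)) (W.point (1, b₁)) x y :=
  switch_of_lt _ _ h.mem₁.2.1.2

theorem bottomColor_end (h : IsTriangle W K a₁ a₂ b₁ b₃ c₂ c₃) (x w z : X) :
    bottomColor W K a₂ b₃ c₂ c₃ x w z (W.len 2) =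
    if c₂ < c₃ then K.crossAct (W.point (1, b₃)) (W.point (2, c₃)) w
      (K.crossAct (W.point (0, a₂)) (W.point (2, c₂)) x z)
    else K.crossAct (W.point (0, a₂)) (W.point (2, c₂)) x
      (K.crossAct (W.point (1, b₃)) (W.point (2, c₃)) w z) := by
  have h2 : c₂ < W.len 2 := h.mem₂.2.1.2
  have h3 : c₃ < W.len 2 := h.mem₃.2.1.2
  unfold bottomColor
  split_ifs
  · rw [switch_of_lt _ _ h2, switch_of_lt _ _ h3]
  · rw [switch_of_lt _ _ h3, switch_of_lt _ _ h2]

end IsTriangle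

end LocalChange

open LocalChange

/-- Both `x ◃ ·` and its inverse are automorphisms of the quandle, so self-distributivity holds for
all combinations of signs. -/
theorem crossAct_crossAct (K L : LinkoidDiagram n m) (p q p' q' : Src n m) (x y z : X) :
    K.crossAct p q x (L.crossAct p' q' y z) =
      L.crossAct p' q' (K.crossAct p q x y) (K.crossAct p q x z) := by
  have h : ∀ y z, x ◃ L.crossAct p' q' y z = L.crossAct p' q' (x ◃ y) (x ◃ z) :=
    map_crossAct ⟨fun y => x ◃ y, Shelf.self_distrib⟩ L p' q'
  by_cases hp : K.IsPositive p q
  · simp only [crossAct, if_pos hp] at h ⊢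
    exact h y z
  · have e : ∀ y, K.crossAct p q x y = x ◃⁻¹ y := fun _ => if_neg hp
    rw [e, e, e, ← Rack.left_cancel x, h]
    simp only [Rack.right_inv x _]

theorem ReidemeisterIII.colorings_correspond (h : ReidemeisterIII L L')
    (P : PointedQuandle.{u} (2 * n)) : ColoringsCorrespond P L L' := by
  obtain ⟨W, a₁, a₂, b₁, b₃, c₂, c₃, a₁', a₂', b₁', b₃', c₂', c₃', hc, hc', h1, h2, h3, hb, hcc,
    hb', hcc'⟩ := h
  have hT := isTriangle_of_crossings_eq hc
  have hT' := isTriangle_of_crossings_eq hc'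
  refine hT.isSolution.colorings_correspond hT'.isSolution fun α => forall_fin_three rfl ?_ ?_
  · change middleColor _ _ _ _ _ _ (W.len 1) = middleColor _ _ _ _ _ _ (W.len 1)
    rw [hT.middleColor_end, hT'.middleColor_end]
    exact crossAct_congr h1 _ _
  · change bottomColor _ _ _ _ _ _ _ _ _ (W.len 2) = bottomColor _ _ _ _ _ _ _ _ _ (W.len 2)
    rw [hT.bottomColor_end, hT'.bottomColor_end]
    -- Self-distributivity moves the action of the top strand on the bottom strand innermost. What
    -- remains is to compare the colors of the middle strand at its crossing with the bottom strand
    -- before and after the move: the one on the left of the top strand must result from the other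
    -- by a positive passage under it.
    simp only [← crossAct_congr h2, ← crossAct_congr h3, crossAct_crossAct L L (W.point (0, a₂))]
    -- At a positive crossing the middle strand passes from right to left under the top strand, so
    -- the point on the left, used in `L`, has the later color and the point on the right, used in
    -- `L'`, the initial one. At a negative crossing the roles are exchanged.
    have hw : W.Pos L (0, a₁) (1, b₁) →
        middleColor W L a₁ b₁ (α 0) (α 1) b₃ =
          L.crossAct (W.point (0, a₁)) (W.point (1, b₁)) (α 0) (α 1) ∧
        middleColor W L' a₁' b₁' (α 0) (α 1) b₃' = α 1 := fun hp =>
      ⟨switch_of_lt _ _ (hb.2 hp), switch_of_le _ _ (hb'.2 (h1.1 hp)).le⟩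
    have hw' : ¬ W.Pos L (0, a₁) (1, b₁) →
        middleColor W L a₁ b₁ (α 0) (α 1) b₃ = α 1 ∧
        middleColor W L' a₁' b₁' (α 0) (α 1) b₃' =
          L.crossAct (W.point (0, a₁)) (W.point (1, b₁)) (α 0) (α 1) := by
      intro hp
      refine ⟨switch_of_le _ _ (not_lt.1 (mt hb.1 hp)), ?_⟩
      rw [crossAct_congr h1]
      exact switch_of_lt _ _ (lt_of_le_of_ne (not_lt.1 fun h => hp (h1.2 (hb'.1 h))) hT'.middle_ne)
    by_cases hp2 : W.Pos L (0, a₂) (2, c₂)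
    · rw [if_pos (hcc.2 hp2), if_neg (hcc'.2 (h2.1 hp2)).not_gt]
      congr 1
      by_cases hp1 : W.Pos L (0, a₁) (1, b₁)
      · rw [(hw hp1).1, (hw hp1).2]
        exact crossAct_congr (iff_of_true hp1 hp2) _ _
      · rw [(hw' hp1).1, (hw' hp1).2]
        exact (crossAct_crossAct_of_not_iff (iff_of_false hp1 (not_not.2 hp2)) _ _).symm
    · have hlt : c₂' < c₃' :=
        lt_of_le_of_ne (not_lt.1 fun h => hp2 (h2.2 (hcc'.1 h))) hT'.bottom_ne
      rw [if_neg (mt hcc.1 hp2), if_pos hlt]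
      congr 1
      by_cases hp1 : W.Pos L (0, a₁) (1, b₁)
      · rw [(hw hp1).1, (hw hp1).2]
        exact crossAct_crossAct_of_not_iff (iff_of_true hp1 hp2) _ _
      · rw [(hw' hp1).1, (hw' hp1).2]
        exact crossAct_congr (iff_of_false hp2 hp1) _ _

end LinkoidDiagram

/-! ### Invariance under equivalence -/

namespace LinkoidDiagram

variable {n m : ℕ} {L L' : LinkoidDiagram n m}

theorem Equivalent.colorings_correspond (h : L.Equivalent L') (P : PointedQuandle.{u} (2 * n)) :
    ColoringsCorrespond P L L' := by
  induction h with
  | rel L L' h =>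
    rcases h with h | h | h | h
    · exact h.colorings_correspond P
    · exact h.colorings_correspond P
    · exact h.colorings_correspond P
    · exact h.colorings_correspond P
  | refl L => exact .refl P L
  | symm L L' _ ih => exact ih.symm
  | trans L L' L'' _ _ ih ih' => exact ih.trans ih'

end LinkoidDiagram

end LinkoidTheory

theorem mainTheorem9 :
    (∀ (n : ℕ) (P : PointedQuandle.{u} (2 * n)) [Finite P.carrier] (S : Set (PointedHom P P))
        (m : ℕ),
      (∀ L : LinkoidDiagram n m, Finite (coloringQuiver L P S).V) ∧
      ∀ L L' : LinkoidDiagram n m, L.Equivalent L' →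
        quiverPolynomial L P S = quiverPolynomial L' P S) ∧
    (∀ (X : Type u) [Quandle X] (k : ℕ) (x : Fin k ≃ X)
        (S : ∀ i j, Set (PointedHom (twoPointed X (x i) (x j)) (twoPointed X (x i) (x j))))
        (m : ℕ) (L L' : LinkoidDiagram 1 m), L.Equivalent L' →
        quiverPolynomialMatrix L x S = quiverPolynomialMatrix L' x S) := by
  refine ⟨fun n P _ S m => ⟨fun L => L.finite_pointedHom P, fun L L' h =>
    (h.colorings_correspond P).quiverPolynomial_eq S⟩, fun X _ k x S m L L' h => ?_⟩
  ext1 i j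
  exact (h.colorings_correspond _).quiverPolynomial_eq (S i j)
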